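/- Let $d\ge 1$. There is a constant $C>0$, depending only on $d$, such that the following holds. Consider a chain of $n\ge 2$ spins of local dimension $d$, with Hilbert space $(\mathbb C^d)^{\otimes n}$, and a Hamiltonian $H=\sum_{i=1}^{n-1}H_i$, where $H_i$ is a Hermitian operator acting on the spins $i$ and $i+1$ with operator norm $\|H_i\|\le 1$. Let $\lambda(H)$ be the smallest eigenvalue of $H$ and let $|\psi\rangle$ be a normalized ground state, i.e. $H|\psi\rangle=\lambda(H)|\psi\rangle$ and $\langle\psi|\psi\rangle=1$. Let $0<\alpha<1$ and let $R_\alpha\in\mathbb R$ be such that for every cut $1\le k\le n-1$ the Rényi entanglement entropy satisfies the area law $$\frac{1}{1-\alpha}\log\operatorname{tr}\bigl(\rho_k^{\alpha}\bigr)\le R_\alpha ,$$ where $\rho_k=\operatorname{tr}_{k+1,\dots,n}|\psi\rangle\langle\psi|$ is the reduced density matrix of the first $k$ spins. Then for every $0<\delta\le 1$ there is a normalized matrix product state $$|\phi\rangle=\sum_{j_1,\dots,j_n=1}^{d}A^{[1]}_{j_1}A^{[2]}_{j_2}\cdots A^{[n]}_{j_n}\,|j_1j_2\cdots j_n\rangle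 ,$$ with complex $D_k\times D_{k+1}$ matrices $A^{[k]}_{j}$ and $D_1=D_{n+1}=1$, whose bond dimension $D=\max_k D_k$ satisfies $$D\le \exp(R_\alpha)\,\bigl(C/\delta\bigr)^{2\alpha/(1-\alpha)},$$ and such that $$\langle\phi|H|\phi\rangle\le\lambda(H)+n\delta .$$ -/

import Mathlib

namespace SpinChain

/-- Pure states of a chain of `n` spins of local dimension `d`: the Hilbert space `(ℂ^d)^{⊗ n}`, written in the
computational basis, which is indexed by the configurations `Fin n → Fin d`. -/
abbrev State (d n : ℕ) : Type := EuclideanSpace ℂ (Fin n → Fin d)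

/-- Operators on a chain of `n` spins, as matrices in the computational basis. -/
abbrev Operator (d n : ℕ) : Type := Matrix (Fin n → Fin d) (Fin n → Fin d) ℂ

/-- Operators on two spins. -/
abbrev TwoSite (d : ℕ) : Type := Matrix (Fin d × Fin d) (Fin d × Fin d) ℂ

/-- The operator norm of a two-spin operator, for the Hilbert space norm on `ℂ^d ⊗ ℂ^d`. -/
noncomputable def opNorm {d : ℕ} (h : TwoSite d) : ℝ :=
  ‖Matrix.toEuclideanCLM (n := Fin d × Fin d) (𝕜 := ℂ) h‖

/-- The two-spin operator `h` acting on the neighbouring spins `i` and `i + 1` of the chain, tensored with the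
identity on all other spins. -/
noncomputable def onBond {d n : ℕ} (i : Fin (n - 1)) (h : TwoSite d) : Operator d n :=
  let l : Fin n := ⟨i, by omega⟩
  let r : Fin n := ⟨i + 1, by omega⟩
  Matrix.of fun σ τ =>
    if ∀ k, k ≠ l → k ≠ r → σ k = τ k then h (σ l, σ r) (τ l, τ r) else 0

/-- The nearest-neighbour Hamiltonian `H = ∑ i, H_i`, where `H_i` acts on the spins `i` and `i + 1`. -/
noncomputable def hamiltonian {d n : ℕ} (h : Fin (n - 1) → TwoSite d) : Operator d n :=
  ∑ i, onBond i (h i)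

/-- The ground-state energy `λ(H)`: the smallest eigenvalue of (the Hermitian operator) `H`. -/
noncomputable def groundEnergy {d n : ℕ} (H : Operator d n) : ℝ :=
  sInf {E : ℝ | ∃ φ : State d n, φ ≠ 0 ∧ Matrix.toEuclideanCLM (𝕜 := ℂ) H φ = (E : ℂ) • φ}

/-- `ψ` is a (normalized) ground state of `H`. -/
def IsGroundState {d n : ℕ} (H : Operator d n) (ψ : State d n) : Prop :=
  ‖ψ‖ = 1 ∧ Matrix.toEuclideanCLM (𝕜 := ℂ) H ψ = (groundEnergy H : ℂ) • ψ

/-- The expectation value `⟨φ|H|φ⟩` (a real number for Hermitian `H`). -/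
noncomputable def expectation {d n : ℕ} (H : Operator d n) (φ : State d n) : ℝ :=
  (inner ℂ φ (Matrix.toEuclideanCLM (𝕜 := ℂ) H φ)).re

/-- The configuration of the whole chain that is `a` on the first `k` spins and `b` on the others. -/
def glue {d n : ℕ} (k : ℕ) (a : {i : Fin n // (i : ℕ) < k} → Fin d)
    (b : {i : Fin n // ¬ (i : ℕ) < k} → Fin d) : Fin n → Fin d :=
  fun i => if hi : (i : ℕ) < k then a ⟨i, hi⟩ else b ⟨i, hi⟩

/-- The reduced density matrix `ρ_A = tr_B |ψ⟩⟨ψ|`, where `A` consists of the first `k` spins and `B` of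
the others. -/
noncomputable def reducedDensity {d n : ℕ} (ψ : State d n) (k : ℕ) :
    Matrix ({i : Fin n // (i : ℕ) < k} → Fin d) ({i : Fin n // (i : ℕ) < k} → Fin d) ℂ :=
  Matrix.of fun a a' => ∑ b, ψ (glue k a b) * star (ψ (glue k a' b))

theorem reducedDensity_isHermitian {d n : ℕ} (ψ : State d n) (k : ℕ) :
    (reducedDensity ψ k).IsHermitian := by
  ext a a'
  simp [reducedDensity, mul_comm]

/-- The Rényi entanglement entropy `R_α(ρ_A) = (1 - α)⁻¹ log tr ρ_A^α` (`0 < α < 1`) of `ψ` across the cut after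
the first `k` spins; `tr ρ_A^α` is the sum of the `α`-th powers of the eigenvalues of `ρ_A`. -/
noncomputable def renyiEntropy {d n : ℕ} (α : ℝ) (ψ : State d n) (k : ℕ) : ℝ :=
  (1 - α)⁻¹ * Real.log (∑ j, (reducedDensity_isHermitian ψ k).eigenvalues j ^ α)

/-- A matrix product representation with open boundary conditions on `n` spins of local dimension `d`. The bonds are
numbered by `0, …, n`, and the matrices at site `k` have size `D k × D (k + 1)`. -/
structure MPS (d n : ℕ) where
  D : Fin (n + 1) → ℕ
  D_pos : ∀ k, 0 < D k
  D_first : D 0 = 1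
  D_last : D (Fin.last n) = 1
  A : (k : Fin n) → Fin d → Matrix (Fin (D k.castSucc)) (Fin (D k.succ)) ℂ

/-- The product of the matrices of the first `k` sites, at the configuration `σ`. -/
noncomputable def MPS.partialProduct {d n : ℕ} (M : MPS d n) (σ : Fin n → Fin d) (k : Fin (n + 1)) :
    Matrix (Fin (M.D 0)) (Fin (M.D k)) ℂ :=
  Fin.induction (motive := fun k => Matrix (Fin (M.D 0)) (Fin (M.D k)) ℂ)
    1 (fun k P => P * M.A k (σ k)) k

/-- The matrix product state: its amplitude at `σ` is the unique entry of the `1 × 1` matrix given by the product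
of all the matrices. -/
noncomputable def MPS.state {d n : ℕ} (M : MPS d n) : State d n :=
  WithLp.toLp 2 fun σ => M.partialProduct σ (Fin.last n) ⟨0, M.D_pos 0⟩ ⟨0, M.D_pos (Fin.last n)⟩

/-- The bond dimension: the largest `D k`. -/
def MPS.bondDim {d n : ℕ} (M : MPS d n) : ℕ :=
  Finset.univ.sup M.D

end SpinChain

/-! Cut the chain into blocks of about `1/s` spins with `s = δ/32`, and build a state that is a
product over blocks and has small Schmidt rank inside each block. The Rényi bound yields at every
cut `k` a spectral projection `P k` of the reduced density matrix, of rank at most `exp R *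
(1/s)^(2α/(1-α))`, with `‖ψ - P k ψ‖ ≤ s` (`exists_threshold`, `exists_truncation`). On `ψ` it
agrees with a projection `Q k` acting on the other side of the cut. Apply to `ψ` the projections at
all cuts inside one block, rightmost cut first.

Swapping `P k` for `Q k` keeps both losses small. The overlap with `ψ` drops only by `s²` per cut,
hence by `O(s)` over a block (`le_re_inner_prodFrom`). Writing `1 + H_i = G_iᴴ G_i`, every
projection except the one at the cut through bond `i` can be commuted past `G_i`, so each bond
energy grows only by `O(s)`, whatever the block length (`norm_apply_prodFrom_le`).

Freezing the spins outside the block, at values found by averaging, turns the result into a state of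
the block alone with no larger energy per norm (`exists_slice_energy_le`, `exists_block`).
Multiplying the blocks together leaves one uncontrolled bond per junction; it costs at most 2, that
is, at most `2s` per spin (`exists_prefix`). The total loss is `32 s = δ` per spin, and bounded
Schmidt ranks give a matrix product state (`exists_mps`). -/

namespace SpinChain

open Finset
open scoped Kronecker

variable {d n : ℕ}

/-! ### Local operators, and amplitudes depending on few spins -/

/-- `X` acts on the sites in `s` only. -/
def ActsOn (s : Finset (Fin n)) (X : Operator d n) : Prop :=
  (∀ σ τ, (∃ k, k ∉ s ∧ σ k ≠ τ k) → X σ τ = 0) ∧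
  ∀ σ τ σ' τ', (∀ k, k ∉ s → σ k = τ k) → (∀ k, k ∉ s → σ' k = τ' k) →
    (∀ k ∈ s, σ k = σ' k) → (∀ k ∈ s, τ k = τ' k) → X σ τ = X σ' τ'

/-- The linear operator with matrix `X`. -/
noncomputable abbrev op (X : Operator d n) : State d n →L[ℂ] State d n :=
  Matrix.toEuclideanCLM (n := Fin n → Fin d) (𝕜 := ℂ) X

theorem op_apply (X : Operator d n) (f : State d n) (σ : Fin n → Fin d) :
    op X f σ = ∑ τ, X σ τ * f τ := by
  simp [op, Matrix.ofLp_toEuclideanCLM, Matrix.mulVec, dotProduct]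

theorem ActsOn.sum_mul {s : Finset (Fin n)} {X : Operator d n} (hX : ActsOn s X)
    (σ : Fin n → Fin d) (F F' : (Fin n → Fin d) → ℂ)
    (h : ∀ τ, (∀ k, k ∉ s → σ k = τ k) → F τ = F' τ) :
    ∑ τ, X σ τ * F τ = ∑ τ, X σ τ * F' τ := by
  refine sum_congr rfl fun τ _ => ?_
  by_cases hτ : ∀ k, k ∉ s → σ k = τ k
  · rw [h τ hτ]
  · push Not at hτ
    rw [hX.1 σ τ hτ]; simp

/-- `X` changes spins only in `s` and `Y` only in `t`, so the one possible intermediate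
configuration is `τ` on `s` and `σ` elsewhere. -/
theorem ActsOn.mul_apply_of_agree {s t : Finset (Fin n)} {X Y : Operator d n}
    (hX : ActsOn s X) (hY : ActsOn t Y) (hst : Disjoint s t) (σ τ : Fin n → Fin d) :
    (X * Y) σ τ = X σ (s.piecewise τ σ) * Y (s.piecewise τ σ) τ := by
  rw [Matrix.mul_apply]
  refine sum_eq_single _ (fun ρ _ hρ => ?_) (by simp)
  by_contra hne
  apply hρ
  funext k
  by_cases hk : k ∈ s
  · rw [piecewise_eq_of_mem _ _ _ hk]
    by_contra hk'
    exact hne (by rw [hY.1 ρ τ ⟨k, disjoint_left.1 hst hk, hk'⟩, mul_zero])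
  · rw [piecewise_eq_of_notMem _ _ _ hk]
    by_contra hk'
    exact hne (by rw [hX.1 σ ρ ⟨k, hk, Ne.symm hk'⟩, zero_mul])

theorem ActsOn.commute {s t : Finset (Fin n)} {X Y : Operator d n}
    (hX : ActsOn s X) (hY : ActsOn t Y) (hst : Disjoint s t) : Commute X Y := by
  ext σ τ
  rw [hX.mul_apply_of_agree hY hst, hY.mul_apply_of_agree hX hst.symm]
  by_cases h : ∀ k, k ∉ s → k ∉ t → σ k = τ k
  · have e : ∀ k, k ∈ t → k ∉ s := fun k hk => disjoint_right.1 hst hk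
    rw [mul_comm]
    congr 1
    · apply hY.2
      · intro k hk
        by_cases hs : k ∈ s <;> simp [Finset.piecewise, hs]
        exact h k hs hk
      · intro k hk
        simp [Finset.piecewise, hk]
      · intro k hk
        simp [Finset.piecewise, e k hk]
      · intro k hk
        simp [Finset.piecewise, hk]
    · apply hX.2
      · intro k hk
        simp [Finset.piecewise, hk]
      · intro k hk
        by_cases ht : k ∈ t <;> simp [Finset.piecewise, ht]
        exact h k hk ht
      · intro k hk
        simp [Finset.piecewise, disjoint_left.1 hst hk]
      · intro k hk
        simp [Finset.piecewise, hk]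
  · push Not at h
    obtain ⟨k, hs, ht, hk⟩ := h
    rw [hY.1 (s.piecewise τ σ) τ ⟨k, ht, by simpa [Finset.piecewise, hs] using hk⟩,
      hX.1 (t.piecewise τ σ) τ ⟨k, hs, by simpa [Finset.piecewise, ht] using hk⟩]
    simp

theorem ActsOn.op_commute {s t : Finset (Fin n)} {X Y : Operator d n}
    (hX : ActsOn s X) (hY : ActsOn t Y) (hst : Disjoint s t) : Commute (op X) (op Y) :=
  (hX.commute hY hst).map (Matrix.toEuclideanCLM (n := Fin n → Fin d) (𝕜 := ℂ))

/-- The pointwise product of two amplitudes. -/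
def pmul (f g : State d n) : State d n := WithLp.toLp 2 fun σ => f σ * g σ

@[simp] theorem pmul_apply (f g : State d n) (σ : Fin n → Fin d) : pmul f g σ = f σ * g σ := rfl

theorem pmul_comm (f g : State d n) : pmul f g = pmul g f := by
  ext σ; simp [mul_comm]

/-- The amplitude `f` depends on the spins in `s` only. -/
def Dep (s : Finset (Fin n)) (f : State d n) : Prop :=
  ∀ σ τ, (∀ k ∈ s, σ k = τ k) → f σ = f τ

theorem Dep.mono {s t : Finset (Fin n)} {f : State d n} (h : Dep s f) (hst : s ⊆ t) : Dep t f :=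
  fun σ τ H => h σ τ fun k hk => H k (hst hk)

theorem Dep.pmul {s : Finset (Fin n)} {f g : State d n} (hf : Dep s f) (hg : Dep s g) :
    Dep s (pmul f g) := fun σ τ H => by simp [hf σ τ H, hg σ τ H]

theorem ActsOn.op_pmul {s t : Finset (Fin n)} {X : Operator d n} (hX : ActsOn s X)
    {f g : State d n} (hg : Dep t g) (hst : Disjoint s t) :
    op X (pmul f g) = pmul (op X f) g := by
  ext σ
  rw [pmul_apply, op_apply, op_apply, Finset.sum_mul]
  simp_rw [pmul_apply, mul_assoc]
  refine hX.sum_mul σ _ _ fun τ h => ?_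
  rw [hg τ σ fun k hk => (h k (disjoint_right.1 hst hk)).symm]

/-- The amplitude `f` with the spins outside `s` frozen to the configuration `τ`. -/
def slice (s : Finset (Fin n)) (τ : Fin n → Fin d) (f : State d n) : State d n :=
  WithLp.toLp 2 fun σ => f (s.piecewise σ τ)

@[simp] theorem slice_apply (s : Finset (Fin n)) (τ : Fin n → Fin d) (f : State d n) (σ) :
    slice s τ f σ = f (s.piecewise σ τ) := rfl

theorem slice_dep (s : Finset (Fin n)) (τ : Fin n → Fin d) (f : State d n) :
    Dep s (slice s τ f) := fun σ σ' h => by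
  refine congrArg f (funext fun k => ?_)
  by_cases hk : k ∈ s <;> simp [Finset.piecewise, hk, h]

/-- Recombination of a pair of configurations along a set of sites. -/
def swapEquiv (s : Finset (Fin n)) :
    (Fin n → Fin d) × (Fin n → Fin d) ≃ (Fin n → Fin d) × (Fin n → Fin d) where
  toFun p := (s.piecewise p.1 p.2, s.piecewise p.2 p.1)
  invFun p := (s.piecewise p.1 p.2, s.piecewise p.2 p.1)
  left_inv p := by
    ext k <;> by_cases hk : k ∈ s <;> simp [Finset.piecewise, hk]
  right_inv p := by
    ext k <;> by_cases hk : k ∈ s <;> simp [Finset.piecewise, hk]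

/-- `swapEquiv` permutes pairs of configurations, and the recombined configuration is its first
component; the other component sums freely. -/
theorem sum_piecewise (s : Finset (Fin n)) (F : (Fin n → Fin d) → ℝ) :
    ∑ τ, ∑ σ, F (s.piecewise σ τ) = Fintype.card (Fin n → Fin d) * ∑ σ, F σ := by
  have h := (swapEquiv (d := d) s).sum_comp (fun p => F p.1)
  rw [Fintype.sum_prod_type_right, Fintype.sum_prod_type_right] at h
  simpa [swapEquiv] using h

theorem sum_norm_slice (s : Finset (Fin n)) (f : State d n) :
    ∑ τ, ‖slice s τ f‖ ^ 2 = Fintype.card (Fin n → Fin d) * ‖f‖ ^ 2 := by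
  simp_rw [EuclideanSpace.norm_sq_eq]
  exact sum_piecewise s fun σ => ‖f σ‖ ^ 2

/-- This replaces multiplicativity of the norm on tensor products. States of a subsystem are kept as
functions on all configurations, so their norms count the ignored spins; the cardinality compensates
for this. -/
theorem card_mul_norm_pmul {s t : Finset (Fin n)} {f g : State d n} (hf : Dep s f) (hg : Dep t g)
    (hst : Disjoint s t) :
    Fintype.card (Fin n → Fin d) * ‖pmul f g‖ ^ 2 = ‖f‖ ^ 2 * ‖g‖ ^ 2 := by
  simp_rw [EuclideanSpace.norm_sq_eq]
  rw [← sum_piecewise s, sum_mul_sum, sum_comm]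
  refine sum_congr rfl fun σ _ => sum_congr rfl fun τ _ => ?_
  rw [pmul_apply, norm_mul, mul_pow,
    hf (s.piecewise σ τ) σ fun k hk => piecewise_eq_of_mem _ _ _ hk,
    hg (s.piecewise σ τ) τ fun k hk => piecewise_eq_of_notMem _ _ _ (disjoint_right.1 hst hk)]

theorem ActsOn.op_slice {s t : Finset (Fin n)} {X : Operator d n} (hX : ActsOn s X) (hst : s ⊆ t)
    (τ : Fin n → Fin d) (f : State d n) : op X (slice t τ f) = slice t τ (op X f) := by
  ext σ
  rw [slice_apply, op_apply, op_apply]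
  have key : ∀ (ρ : Fin n → Fin d) (F : (Fin n → Fin d) → ℂ), ∑ τ, X ρ τ * F τ =
      ∑ τ ∈ univ.filter (fun τ : Fin n → Fin d => ∀ k, k ∉ s → ρ k = τ k), X ρ τ * F τ := by
    intro ρ F
    symm
    refine sum_subset (subset_univ _) fun τ _ hτ => ?_
    simp only [mem_filter, mem_univ, true_and, not_forall] at hτ
    obtain ⟨k, hk, h⟩ := hτ
    rw [hX.1 ρ τ ⟨k, hk, h⟩, zero_mul]
  rw [key, key]
  -- Only configurations agreeing with the row index off `s` contribute. Since `s ⊆ t`, those of the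
  -- two sums correspond by exchanging the spins outside `t` between `σ` and `τ`.
  refine sum_nbij' (fun ρ => t.piecewise ρ τ) (fun ρ => t.piecewise ρ σ) ?_ ?_ ?_ ?_ ?_
  · intro ρ hρ
    simp only [mem_filter, mem_univ, true_and] at hρ ⊢
    intro k hk
    by_cases ht : k ∈ t <;> simp [Finset.piecewise, ht, hρ k hk]
  · intro ρ hρ
    simp only [mem_filter, mem_univ, true_and] at hρ ⊢
    intro k hk
    have := hρ k hk
    by_cases ht : k ∈ t <;> simp_all [Finset.piecewise]
  · intro ρ hρ
    simp only [mem_filter, mem_univ, true_and] at hρ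
    funext k
    by_cases ht : k ∈ t
    · simp [Finset.piecewise, ht]
    · simp [Finset.piecewise, ht, hρ k (fun h => ht (hst h))]
  · intro ρ hρ
    simp only [mem_filter, mem_univ, true_and] at hρ
    funext k
    by_cases ht : k ∈ t
    · simp [Finset.piecewise, ht]
    · have := hρ k (fun h => ht (hst h))
      simp_all [Finset.piecewise]
  · intro ρ hρ
    simp only [mem_filter, mem_univ, true_and] at hρ
    rw [slice_apply]
    congr 1
    apply hX.2
    · exact hρ
    · intro k hk
      by_cases ht : k ∈ t <;> simp [Finset.piecewise, ht, hρ k hk]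
    · intro k hk
      simp [Finset.piecewise, hst hk]
    · intro k hk
      simp [Finset.piecewise, hst hk]

theorem ActsOn.dep_op {s t : Finset (Fin n)} {X : Operator d n} (hX : ActsOn s X) (hst : s ⊆ t)
    {f : State d n} (hf : Dep t f) : Dep t (op X f) := by
  intro σ σ' h
  have e : ∀ τ, slice t τ f = f := fun τ => by
    ext ρ
    exact hf _ _ fun k hk => piecewise_eq_of_mem _ _ _ hk
  rw [← e σ, hX.op_slice hst]
  exact slice_dep t σ _ σ σ' h

theorem norm_op_sq (X : Operator d n) (f : State d n) :
    ‖op X f‖ ^ 2 = (inner ℂ f (op (X.conjTranspose * X) f)).re := by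
  have h : op (X.conjTranspose * X) = (op X).adjoint * op X := by
    rw [op, op, map_mul, ← Matrix.star_eq_conjTranspose, map_star,
      ContinuousLinearMap.star_eq_adjoint]
  rw [h, mul_apply_eq_comp, ContinuousLinearMap.adjoint_inner_right,
    inner_self_eq_norm_sq_to_K]
  norm_cast

/-! ### Bond terms and square roots of `1 + H_i` -/

/-- The sites of the bond `i`. -/
def bondSites (i : Fin (n - 1)) : Finset (Fin n) :=
  univ.filter fun k => (k : ℕ) = i ∨ (k : ℕ) = i + 1

theorem mem_bondSites {i : Fin (n - 1)} {k : Fin n} :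
    k ∈ bondSites i ↔ (k : ℕ) = i ∨ (k : ℕ) = i + 1 := by simp [bondSites]

theorem onBond_actsOn (i : Fin (n - 1)) (h : TwoSite d) :
    ActsOn (bondSites i) (onBond (n := n) i h) := by
  have e : ∀ σ τ : Fin n → Fin d, (∀ k, k ≠ ⟨i, by omega⟩ → k ≠ ⟨i + 1, by omega⟩ → σ k = τ k) ↔
      ∀ k, k ∉ bondSites i → σ k = τ k := by
    intro σ τ
    simp only [mem_bondSites, Fin.ext_iff, not_or, and_imp, ne_eq]
  refine ⟨fun σ τ ⟨k, hk, hne⟩ => ?_, fun σ τ σ' τ' h1 h2 h3 h4 => ?_⟩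
  · simp only [onBond, Matrix.of_apply]
    rw [if_neg]
    rw [e]
    exact fun H => hne (H k hk)
  · simp only [onBond, Matrix.of_apply]
    rw [if_pos ((e _ _).2 h1), if_pos ((e _ _).2 h2)]
    rw [h3 _ (mem_bondSites.2 (Or.inl rfl)), h3 _ (mem_bondSites.2 (Or.inr rfl)),
      h4 _ (mem_bondSites.2 (Or.inl rfl)), h4 _ (mem_bondSites.2 (Or.inr rfl))]

/-- Splitting a configuration into the two spins of the bond `i` and the others. -/
def bondEquiv (i : Fin (n - 1)) :
    (Fin n → Fin d) ≃ (Fin d × Fin d) × ({k : Fin n // k ∉ bondSites i} → Fin d) where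
  toFun σ := ((σ ⟨i, by omega⟩, σ ⟨i + 1, by omega⟩), fun k => σ k)
  invFun p k := if (k : ℕ) = i then p.1.1 else if (k : ℕ) = i + 1 then p.1.2 else
    if hk : k ∉ bondSites i then p.2 ⟨k, hk⟩ else p.1.1
  left_inv σ := by
    funext k
    by_cases h1 : (k : ℕ) = i
    · have : k = ⟨i, by omega⟩ := Fin.ext h1
      simp [h1, ← this]
    · by_cases h2 : (k : ℕ) = i + 1
      · have : k = ⟨i + 1, by omega⟩ := Fin.ext h2
        simp [h2, ← this]
      · simp [h1, h2, mem_bondSites]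
  right_inv p := by
    refine Prod.ext (Prod.ext ?_ ?_) (funext fun k => ?_)
    · simp
    · simp
    · have := k.2
      simp only [mem_bondSites, not_or] at this
      simp [this.1, this.2, mem_bondSites]

/-- In this form sums, products and adjoints of bond operators follow from the algebra of Kronecker
products. -/
theorem onBond_eq_submatrix (i : Fin (n - 1)) (h : TwoSite d) :
    onBond (n := n) i h = (h ⊗ₖ (1 : Matrix ({k : Fin n // k ∉ bondSites i} → Fin d) _ ℂ)).submatrix
      (bondEquiv i) (bondEquiv i) := by
  ext σ τ
  have e : (∀ k, k ≠ ⟨i, by omega⟩ → k ≠ ⟨i + 1, by omega⟩ → σ k = τ k) ↔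
      (bondEquiv i σ).2 = (bondEquiv i τ).2 := by
    simp only [bondEquiv, Equiv.coe_fn_mk, funext_iff, Subtype.forall, mem_bondSites, Fin.ext_iff,
      not_or, and_imp, ne_eq]
  simp only [onBond, Matrix.of_apply, Matrix.submatrix_apply, Matrix.kroneckerMap_apply,
    Matrix.one_apply, ← e, mul_ite, mul_one, mul_zero]
  rfl

theorem onBond_add (i : Fin (n - 1)) (h h' : TwoSite d) :
    onBond (n := n) i (h + h') = onBond i h + onBond i h' := by
  simp_rw [onBond_eq_submatrix, Matrix.add_kronecker]; rfl

theorem onBond_sub (i : Fin (n - 1)) (h h' : TwoSite d) :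
    onBond (n := n) i (h - h') = onBond i h - onBond i h' := by
  rw [eq_sub_iff_add_eq, ← onBond_add, sub_add_cancel]

theorem onBond_one (i : Fin (n - 1)) : onBond (n := n) i (1 : TwoSite d) = 1 := by
  simp [onBond_eq_submatrix, Matrix.submatrix_one_equiv]

theorem onBond_conjTranspose_mul_self (i : Fin (n - 1)) (h : TwoSite d) :
    (onBond (n := n) i h).conjTranspose * onBond i h = onBond i (h.conjTranspose * h) := by
  simp_rw [onBond_eq_submatrix, Matrix.conjTranspose_submatrix, Matrix.conjTranspose_kronecker,
    Matrix.submatrix_mul_equiv, ← Matrix.mul_kronecker_mul, Matrix.conjTranspose_one, mul_one]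

theorem abs_re_inner_le_of_opNorm_le_one {h : TwoSite d} (hh : opNorm h ≤ 1) (x : Fin d × Fin d → ℂ) :
    |(star x ⬝ᵥ h.mulVec x).re| ≤ (star x ⬝ᵥ x).re := by
  set v : EuclideanSpace ℂ (Fin d × Fin d) := WithLp.toLp 2 x
  have e1 : star x ⬝ᵥ h.mulVec x
      = inner ℂ v (Matrix.toEuclideanCLM (n := Fin d × Fin d) (𝕜 := ℂ) h v) := by
    rw [EuclideanSpace.inner_eq_star_dotProduct, Matrix.ofLp_toEuclideanCLM, dotProduct_comm]
  have e2 : (star x ⬝ᵥ x).re = ‖v‖ ^ 2 := by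
    have : star x ⬝ᵥ x = inner ℂ v v := by
      rw [EuclideanSpace.inner_eq_star_dotProduct, dotProduct_comm]
    rw [this, inner_self_eq_norm_sq_to_K]
    norm_cast
  rw [e1, e2]
  refine (Complex.abs_re_le_norm _).trans ((norm_inner_le_norm _ _).trans ?_)
  have := (Matrix.toEuclideanCLM (n := Fin d × Fin d) (𝕜 := ℂ) h).le_of_opNorm_le hh v
  rw [one_mul] at this
  nlinarith [norm_nonneg v]

open scoped ComplexOrder MatrixOrder Matrix.Norms.L2Operator in
theorem exists_factor_of_re_nonneg {h : TwoSite d} (hH : h.IsHermitian)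
    (hp : ∀ x : Fin d × Fin d → ℂ, 0 ≤ (star x ⬝ᵥ h.mulVec x).re) :
    ∃ B : TwoSite d, h = B.conjTranspose * B := by
  have : h.PosSemidef := by
    refine Matrix.PosSemidef.of_dotProduct_mulVec_nonneg hH fun x => ?_
    rw [Complex.le_def]
    exact ⟨hp x, (hH.im_star_dotProduct_mulVec_self x).symm⟩
  exact CStarAlgebra.nonneg_iff_eq_star_mul_self.mp this.nonneg

/-- A square root of `1 + h`, acting on the bond `i`. -/
theorem exists_bond_factor (i : Fin (n - 1)) {h : TwoSite d} (hH : h.IsHermitian)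
    (hh : opNorm h ≤ 1) :
    ∃ G : Operator d n, ActsOn (bondSites i) G ∧
      (∀ f, ‖op G f‖ ^ 2 = ‖f‖ ^ 2 + (inner ℂ f (op (onBond i h) f)).re) ∧
      ∀ f, ‖op G f‖ ^ 2 ≤ 2 * ‖f‖ ^ 2 := by
  have hone : (1 : TwoSite d).IsHermitian := Matrix.isHermitian_one
  obtain ⟨B, hB⟩ := exists_factor_of_re_nonneg (hone.add hH) fun x => by
    have := abs_le.1 (abs_re_inner_le_of_opNorm_le_one hh x)
    rw [Matrix.add_mulVec, Matrix.one_mulVec, dotProduct_add, Complex.add_re]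
    linarith
  -- The factor of `1 - h` serves only the upper bound: `‖G f‖²` and `‖B' f‖²` add up to `2‖f‖²`.
  obtain ⟨B', hB'⟩ := exists_factor_of_re_nonneg (hone.sub hH) fun x => by
    have := abs_le.1 (abs_re_inner_le_of_opNorm_le_one hh x)
    rw [Matrix.sub_mulVec, Matrix.one_mulVec, dotProduct_sub, Complex.sub_re]
    linarith
  have key : ∀ f : State d n, (inner ℂ f f).re = ‖f‖ ^ 2 := fun f => by
    rw [inner_self_eq_norm_sq_to_K]; norm_cast
  have h1 : ∀ f, ‖op (onBond i B) f‖ ^ 2 = ‖f‖ ^ 2 + (inner ℂ f (op (onBond i h) f)).re := by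
    intro f
    rw [norm_op_sq, onBond_conjTranspose_mul_self, ← hB, onBond_add, onBond_one, op, map_add, map_one,
      add_apply, one_apply_eq_self, inner_add_right, Complex.add_re,
      key]
  have h2 : ∀ f, ‖op (onBond i B') f‖ ^ 2 = ‖f‖ ^ 2 - (inner ℂ f (op (onBond i h) f)).re := by
    intro f
    rw [norm_op_sq, onBond_conjTranspose_mul_self, ← hB', onBond_sub, onBond_one, op, map_sub, map_one,
      sub_apply, one_apply_eq_self, inner_sub_right, Complex.sub_re,
      key]
  refine ⟨onBond i B, onBond_actsOn i B, h1, fun f => ?_⟩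
  have := h2 f
  have := h1 f
  nlinarith [sq_nonneg ‖op (onBond i B') f‖]

/-! ### Products of projections that can be moved across their cut -/

section Abstract

variable {E : Type*} [NormedAddCommGroup E] [InnerProductSpace ℂ E]

/-- The product `P (a + 1) * P (a + 2) * ⋯ * P (a + l)`. -/
def prodFrom (P : ℕ → E →L[ℂ] E) (a : ℕ) : ℕ → E →L[ℂ] E
  | 0 => 1
  | l + 1 => prodFrom P a l * P (a + l + 1)

theorem prodFrom_commute {P : ℕ → E →L[ℂ] E} {a l : ℕ} {X : E →L[ℂ] E}
    (h : ∀ k, a < k → k ≤ a + l → Commute X (P k)) : Commute X (prodFrom P a l) := by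
  induction l with
  | zero => exact Commute.one_right X
  | succ l ih =>
    exact (ih fun k h1 h2 => h k h1 (by omega)).mul_right (h _ (by omega) (by omega))

theorem prodFrom_norm_le {P : ℕ → E →L[ℂ] E} {a l : ℕ}
    (h : ∀ k, a < k → k ≤ a + l → ∀ x, ‖P k x‖ ≤ ‖x‖) (x : E) : ‖prodFrom P a l x‖ ≤ ‖x‖ := by
  induction l generalizing x with
  | zero => exact le_rfl
  | succ l ih =>
    exact (ih (fun k h1 h2 => h k h1 (by omega)) _).trans (h _ (by omega) (by omega) x)

/-- Projecting successively, with projections that may be moved to the complementary side of the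
cut, the overlap with the initial vector decreases linearly only. -/
theorem le_re_inner_prodFrom {P Q : ℕ → E →L[ℂ] E} {a l : ℕ} {ψ : E} {ε : ℝ} (hψ : ‖ψ‖ = 1)
    (hP : ∀ k, a < k → k ≤ a + l → ∀ x, ‖P k x‖ ≤ ‖x‖)
    (hQ : ∀ k, a < k → k ≤ a + l → ∀ x y, inner ℂ (Q k x) y = inner ℂ x (Q k y))
    (hQQ : ∀ k, a < k → k ≤ a + l → Q k * Q k = Q k)
    (hPQ : ∀ k, a < k → k ≤ a + l → P k ψ = Q k ψ)
    (hc : ∀ k, a < k → k ≤ a + l → ∀ j, a < j → j ≤ k → Commute (Q k) (P j))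
    (hε : ∀ k, a < k → k ≤ a + l → ‖ψ - P k ψ‖ ^ 2 ≤ ε) :
    1 - l * ε ≤ (inner ℂ ψ (prodFrom P a l ψ)).re := by
  induction l with
  | zero =>
    simp [prodFrom, inner_self_eq_norm_sq_to_K, hψ]
  | succ l ih =>
    have ih' := ih (fun k h1 h2 => hP k h1 (by omega)) (fun k h1 h2 => hQ k h1 (by omega))
      (fun k h1 h2 => hQQ k h1 (by omega)) (fun k h1 h2 => hPQ k h1 (by omega))
      (fun k h1 h2 => hc k h1 (by omega)) (fun k h1 h2 => hε k h1 (by omega))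
    set T := prodFrom P a l with hT
    set k := a + l + 1 with hk
    have k1 : a < k := by omega
    have k2 : k ≤ a + (l + 1) := by omega
    -- `Q k` kills `χ` and commutes with `T`, so `T χ` is orthogonal to `Q k ψ` and `⟨ψ, T χ⟩ = ⟨χ,
    -- T χ⟩`. The loss is thus quadratic in `‖χ‖`.
    set χ := ψ - Q k ψ with hχ
    have hcT : Commute (Q k) T := prodFrom_commute fun j h1 h2 => hc k k1 k2 j h1 (by omega)
    have hQχ : Q k χ = 0 := by
      have : Q k (Q k ψ) = Q k ψ := by
        rw [← mul_apply_eq_comp, hQQ k k1 k2]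
      rw [hχ, map_sub, this, sub_self]
    have e1 : inner ℂ (Q k ψ) (T χ) = 0 := by
      rw [hQ k k1 k2, ← mul_apply_eq_comp, hcT.eq, mul_apply_eq_comp, hQχ,
        map_zero, inner_zero_right]
    have e2 : inner ℂ ψ (T χ) = inner ℂ χ (T χ) := by
      rw [hχ, inner_sub_left, ← hχ, e1, sub_zero]
    have e3 : (inner ℂ χ (T χ)).re ≤ ε := by
      have h1 : ‖T χ‖ ≤ ‖χ‖ := prodFrom_norm_le (fun j h1 h2 => hP j h1 (by omega)) χ
      have h2 := hε k k1 k2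
      rw [hPQ k k1 k2, ← hχ] at h2
      refine (Complex.re_le_norm _).trans ((norm_inner_le_norm _ _).trans ?_)
      nlinarith [norm_nonneg χ]
    have e4 : prodFrom P a (l + 1) ψ = T ψ - T χ := by
      rw [hχ, map_sub, sub_sub_cancel, ← hPQ k k1 k2]; rfl
    rw [e4, inner_sub_right, Complex.sub_re, e2]
    push_cast
    linarith

/-- Only the projection at the cut `i + 1` increases the energy of the bond `i`. -/
theorem norm_apply_prodFrom_le {P Q : ℕ → E →L[ℂ] E} {a l i : ℕ} {ψ : E} {c : ℝ} (hc0 : 0 ≤ c)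
    {G : E →L[ℂ] E}
    (hP : ∀ k, a < k → k ≤ a + l → ∀ x, ‖P k x‖ ≤ ‖x‖)
    (hQ : ∀ k, a < k → k ≤ a + l → ∀ x, ‖Q k x‖ ≤ ‖x‖)
    (hPQ : ∀ k, a < k → k ≤ a + l → P k ψ = Q k ψ)
    (hc : ∀ k, a < k → k ≤ a + l → ∀ j, a < j → j ≤ k → Commute (Q k) (P j))
    (hGP : ∀ k, a < k → k ≤ a + l → k ≤ i → Commute G (P k))
    (hGQ : ∀ k, a < k → k ≤ a + l → i + 2 ≤ k → Commute G (Q k))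
    (hG : ∀ k, a < k → k ≤ a + l → ‖G (ψ - P k ψ)‖ ≤ c) :
    ‖G (prodFrom P a l ψ)‖ ≤ ‖G ψ‖ + c := by
  induction l with
  | zero => simpa [prodFrom] using hc0
  | succ l ih =>
    have ih' := ih (fun k h1 h2 => hP k h1 (by omega)) (fun k h1 h2 => hQ k h1 (by omega))
      (fun k h1 h2 => hPQ k h1 (by omega))
      (fun k h1 h2 => hc k h1 (by omega)) (fun k h1 h2 => hGP k h1 (by omega))
      (fun k h1 h2 => hGQ k h1 (by omega)) (fun k h1 h2 => hG k h1 (by omega))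
    have k1 : a < a + l + 1 := by omega
    have k2 : a + l + 1 ≤ a + (l + 1) := by omega
    have e0 : prodFrom P a (l + 1) ψ = prodFrom P a l (P (a + l + 1) ψ) := rfl
    -- Compare the newest cut with the cut `i + 1` separating the sites `i` and `i + 1`. Left of it,
    -- `G` passes through the whole product. At it, `G` passes through the earlier factors and the
    -- error `c` is paid. Right of it, `P` is replaced by `Q`, which commutes to the far left and is
    -- dropped.
    rcases lt_trichotomy (a + l + 1) (i + 1) with h | h | h
    · have hcG : Commute G (prodFrom P a (l + 1)) :=
        prodFrom_commute fun k h1 h2 => hGP k h1 h2 (by omega)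
      rw [← mul_apply_eq_comp, hcG.eq, mul_apply_eq_comp]
      linarith [prodFrom_norm_le hP (G ψ)]
    · have hcG : Commute G (prodFrom P a l) :=
        prodFrom_commute fun k h1 h2 => hGP k h1 (by omega) (by omega)
      rw [e0, ← mul_apply_eq_comp, hcG.eq, mul_apply_eq_comp]
      refine (prodFrom_norm_le (fun k h1 h2 => hP k h1 (by omega)) _).trans ?_
      have e : G (P (a + l + 1) ψ) = G ψ - G (ψ - P (a + l + 1) ψ) := by
        rw [map_sub, sub_sub_cancel]
      rw [e]
      exact (norm_sub_le _ _).trans (by linarith [hG _ k1 k2])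
    · have hcG : Commute (Q (a + l + 1)) (G * prodFrom P a l) :=
        (hGQ _ k1 k2 (by omega)).symm.mul_right
          (prodFrom_commute fun k h1 h2 => hc _ k1 k2 k h1 (by omega))
      rw [e0, hPQ _ k1 k2, ← mul_apply_eq_comp, ← mul_apply_eq_comp,
        ← hcG.eq]
      exact (hQ _ k1 k2 _).trans ih'

end Abstract

/-! ### Spectral truncation from the Rényi entropy -/

/-- A threshold on the spectrum that bounds both the number of large eigenvalues and the sum of the
small ones in terms of the Rényi entropy. -/
theorem exists_threshold {ι : Type*} [Fintype ι] (μ : ι → ℝ) (hμ : ∀ j, 0 ≤ μ j) {α R s : ℝ}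
    (h0 : 0 < α) (h1 : α < 1) (hR : (1 - α)⁻¹ * Real.log (∑ j, μ j ^ α) ≤ R) (hs : 0 < s) :
    ∃ t, 0 < t ∧ ((univ.filter fun j => t < μ j).card : ℝ) ≤ Real.exp R * s⁻¹ ^ (2 * α / (1 - α)) ∧
      ∑ j ∈ univ.filter (fun j => ¬ t < μ j), μ j ≤ s ^ 2 := by
  have h1' : 0 < 1 - α := by linarith
  set A := ∑ j, μ j ^ α with hA
  have hAR : A ≤ Real.exp ((1 - α) * R) := by
    refine (Real.le_exp_log A).trans (Real.exp_le_exp.2 ?_)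
    have := mul_le_mul_of_nonneg_left hR h1'.le
    rwa [← mul_assoc, mul_inv_cancel₀ h1'.ne', one_mul] at this
  -- This is `t = e^(-R) s^(2/(1-α))`, the solution of `t^(1-α) e^((1-α)R) = s²`. The tail bound
  -- uses `μ ≤ t^(1-α) μ^α` for `μ ≤ t`; the count uses `t^α ≤ μ^α` for `μ > t`.
  set t := Real.exp (-R + (2 / (1 - α)) * Real.log s) with ht
  have ht0 : 0 < t := Real.exp_pos _
  refine ⟨t, ht0, ?_, ?_⟩
  · have e : Real.exp R * s⁻¹ ^ (2 * α / (1 - α)) = Real.exp ((1 - α) * R) / t ^ α := by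
      rw [Real.rpow_def_of_pos (inv_pos.2 hs), ht, ← Real.exp_mul, ← Real.exp_add, ← Real.exp_sub,
        Real.log_inv]
      congr 1
      field_simp
      ring
    rw [e, le_div_iff₀ (Real.rpow_pos_of_pos ht0 _)]
    refine le_trans ?_ hAR
    rw [← nsmul_eq_mul]
    refine (card_nsmul_le_sum _ (fun j => μ j ^ α) _ fun j hj => ?_).trans
      (sum_le_sum_of_subset_of_nonneg (filter_subset _ _) fun j _ _ => Real.rpow_nonneg (hμ j) _)
    exact Real.rpow_le_rpow ht0.le (mem_filter.1 hj).2.le h0.le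
  · have e : s ^ 2 = t ^ (1 - α) * Real.exp ((1 - α) * R) := by
      rw [ht, ← Real.exp_mul, ← Real.exp_add, ← Real.rpow_natCast, Real.rpow_def_of_pos hs]
      congr 1
      push_cast
      field_simp
      ring
    rw [e]
    calc ∑ j ∈ univ.filter (fun j => ¬ t < μ j), μ j
        ≤ ∑ j ∈ univ.filter (fun j => ¬ t < μ j), t ^ (1 - α) * μ j ^ α := by
          refine sum_le_sum fun j hj => ?_
          have hj' : μ j ≤ t := not_lt.1 (mem_filter.1 hj).2
          rcases (hμ j).eq_or_lt with h | h
          · rw [← h]; positivity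
          · calc μ j = μ j ^ (1 - α) * μ j ^ α := by
                  rw [← Real.rpow_add h, sub_add_cancel, Real.rpow_one]
              _ ≤ _ := mul_le_mul_of_nonneg_right (Real.rpow_le_rpow h.le hj' h1'.le)
                  (Real.rpow_nonneg h.le _)
      _ = t ^ (1 - α) * ∑ j ∈ univ.filter (fun j => ¬ t < μ j), μ j ^ α := by rw [mul_sum]
      _ ≤ _ := by
          refine mul_le_mul_of_nonneg_left (le_trans ?_ hAR) (by positivity)
          exact sum_le_sum_of_subset_of_nonneg (filter_subset _ _)
            fun j _ _ => Real.rpow_nonneg (hμ j) _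

/-- The spectral projection of `M Mᴴ` above a positive threshold, acting on `M` from the left, is
the same as a projection acting from the right. -/
theorem exists_spectral_projections {l r : Type*} [Fintype l] [DecidableEq l] [Fintype r]
    [DecidableEq r] (M : Matrix l r ℂ) {ρ : Matrix l l ℂ}
    (hM : ρ = M * M.conjTranspose) (hH : ρ.IsHermitian) {t : ℝ}
    (ht : 0 < t) :
    ∃ (P : Matrix l l ℂ) (Q : Matrix r r ℂ), P.IsHermitian ∧ P * P = P ∧ Q.IsHermitian ∧
      Q * Q = Q ∧ P * M = M * Q ∧
      ((1 - P) * ρ).trace =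
        ((∑ j ∈ univ.filter (fun j => ¬ t < hH.eigenvalues j), hH.eigenvalues j : ℝ) : ℂ) ∧
      ∃ U : l → l → ℂ, ∀ a b, P a b =
        ∑ j ∈ univ.filter (fun j => t < hH.eigenvalues j), U a j * star (U b j) := by
  set μ := hH.eigenvalues with hμ
  set U : Matrix l l ℂ := (hH.eigenvectorUnitary : Matrix l l ℂ) with hU
  have hUU : U.conjTranspose * U = 1 := by
    rw [← Matrix.star_eq_conjTranspose]; exact Unitary.coe_star_mul_self hH.eigenvectorUnitary
  have hUU' : U * U.conjTranspose = 1 := by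
    rw [← Matrix.star_eq_conjTranspose]; exact Unitary.coe_mul_star_self hH.eigenvectorUnitary
  -- The functional calculus of `ρ`: prescribed eigenvalues in the eigenbasis of `ρ`.
  let F : (l → ℂ) → Matrix l l ℂ := fun v => U * Matrix.diagonal v * U.conjTranspose
  have hF : ∀ v w, F v * F w = F (v * w) := by
    intro v w
    calc F v * F w = U * Matrix.diagonal v * (U.conjTranspose * U) * Matrix.diagonal w
          * U.conjTranspose := by simp only [F, mul_assoc]
      _ = F (v * w) := by
          rw [hUU, mul_one, mul_assoc U, Matrix.diagonal_mul_diagonal]; rfl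
  have hFH : ∀ v, (∀ j, star (v j) = v j) → (F v).IsHermitian := by
    intro v hv
    have : star v = v := funext hv
    rw [Matrix.IsHermitian]
    simp only [F, Matrix.conjTranspose_mul, Matrix.conjTranspose_conjTranspose,
      Matrix.diagonal_conjTranspose, this, mul_assoc]
  have hρ : ρ = F fun j => (μ j : ℂ) := by
    conv_lhs => rw [hH.spectral_theorem, Unitary.conjStarAlgAut_apply]
    rfl
  have hone : F 1 = 1 := by
    have : (Matrix.diagonal (1 : l → ℂ)) = 1 := Matrix.diagonal_one
    simp only [F, this, mul_one, hUU']
  have hsub : ∀ v w, F v - F w = F (v - w) := by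
    intro v w
    simp only [F, ← sub_mul, ← mul_sub, Matrix.diagonal_sub]; rfl
  have htr : ∀ v, (F v).trace = ∑ j, v j := by
    intro v
    simp only [F]
    rw [Matrix.trace_mul_comm, ← mul_assoc, hUU, one_mul, Matrix.trace_diagonal]
  let p : l → ℂ := fun j => if t < μ j then 1 else 0
  -- Inverting `ρ` on its large eigenvalues gives `F p = ρ * F w = M * Mᴴ * F w`. Hence `F p * M = M
  -- * (Mᴴ * F w * M)`, which dictates the projection on the right.
  let w : l → ℂ := fun j => if t < μ j then (μ j : ℂ)⁻¹ else 0
  have hp : (fun j => (μ j : ℂ)) * w = p := by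
    funext j
    by_cases h : t < μ j
    · have : (μ j : ℂ) ≠ 0 := by exact_mod_cast (ht.trans h).ne'
      simp [p, w, h, this]
    · simp [p, w, h]
  have hw : w * p = w := by
    funext j; by_cases h : t < μ j <;> simp [p, w, h]
  have hwH : (F w).IsHermitian := hFH _ fun j => by by_cases h : t < μ j <;> simp [w, h]
  refine ⟨F p, M.conjTranspose * F w * M, hFH _ fun j => by by_cases h : t < μ j <;> simp [p, h],
    ?_, ?_, ?_, ?_, ?_, U, ?_⟩
  · rw [hF]; congr 1; funext j; by_cases h : t < μ j <;> simp [p, h]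
  · rw [Matrix.IsHermitian]
    simp only [Matrix.conjTranspose_mul, Matrix.conjTranspose_conjTranspose, hwH.eq, Matrix.mul_assoc]
  · calc M.conjTranspose * F w * M * (M.conjTranspose * F w * M)
        = M.conjTranspose * (F w * ((M * M.conjTranspose) * F w)) * M := by
          simp only [Matrix.mul_assoc]
      _ = _ := by rw [← hM, hρ, hF, hF, hp, hw]
  · rw [← hp, ← hF, ← hρ, hM]; simp only [Matrix.mul_assoc]
  · rw [hρ, ← hone, hsub, hF, htr, sum_filter, Complex.ofReal_sum]
    refine sum_congr rfl fun j _ => ?_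
    by_cases h : t < μ j <;> simp [p, h]
  · intro a b
    simp only [F, Matrix.mul_apply, Matrix.diagonal_apply, mul_ite, mul_zero, sum_ite_eq', mem_univ,
      if_true, sum_filter]
    refine sum_congr rfl fun j _ => ?_
    by_cases h : t < μ j <;> simp [p, h]

/-! ### Cuts of the chain and Schmidt truncation -/

/-- Splitting a configuration at the cut after the first `k` spins. -/
def cutEquiv (d n k : ℕ) : (Fin n → Fin d) ≃
    ({i : Fin n // (i : ℕ) < k} → Fin d) × ({i : Fin n // ¬ (i : ℕ) < k} → Fin d) where
  toFun σ := (fun i => σ i, fun i => σ i)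
  invFun p := glue k p.1 p.2
  left_inv σ := by
    funext i; simp [glue]
  right_inv p := by
    refine Prod.ext (funext fun i => ?_) (funext fun i => ?_)
    · simp [glue, i.2]
    · have := i.2
      simp only [not_lt] at this
      simp [glue, this]

/-- The sites to the left of the cut `k`. -/
def leftSites (n k : ℕ) : Finset (Fin n) := univ.filter fun i => (i : ℕ) < k

/-- The sites to the right of the cut `k`. -/
def rightSites (n k : ℕ) : Finset (Fin n) := univ.filter fun i => ¬ (i : ℕ) < k

@[simp] theorem mem_leftSites {k : ℕ} {i : Fin n} : i ∈ leftSites n k ↔ (i : ℕ) < k := by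
  simp [leftSites]

@[simp] theorem mem_rightSites {k : ℕ} {i : Fin n} : i ∈ rightSites n k ↔ k ≤ (i : ℕ) := by
  simp [rightSites]

/-- The operator `P ⊗ 1` for the cut after the first `k` spins. -/
noncomputable def leftOp (k : ℕ) (P : Matrix ({i : Fin n // (i : ℕ) < k} → Fin d)
    ({i : Fin n // (i : ℕ) < k} → Fin d) ℂ) : Operator d n :=
  (P ⊗ₖ (1 : Matrix ({i : Fin n // ¬ (i : ℕ) < k} → Fin d) _ ℂ)).submatrix
    (cutEquiv d n k) (cutEquiv d n k)

/-- The operator `1 ⊗ Q` for the cut after the first `k` spins. -/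
noncomputable def rightOp (k : ℕ) (Q : Matrix ({i : Fin n // ¬ (i : ℕ) < k} → Fin d)
    ({i : Fin n // ¬ (i : ℕ) < k} → Fin d) ℂ) : Operator d n :=
  ((1 : Matrix ({i : Fin n // (i : ℕ) < k} → Fin d) _ ℂ) ⊗ₖ Q).submatrix
    (cutEquiv d n k) (cutEquiv d n k)

theorem leftOp_actsOn (k : ℕ) (P : Matrix ({i : Fin n // (i : ℕ) < k} → Fin d) _ ℂ) :
    ActsOn (leftSites n k) (leftOp k P) := by
  have e : ∀ σ τ : Fin n → Fin d, (cutEquiv d n k σ).2 = (cutEquiv d n k τ).2 ↔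
      ∀ i, i ∉ leftSites n k → σ i = τ i := by
    intro σ τ
    simp only [cutEquiv, Equiv.coe_fn_mk, funext_iff, Subtype.forall, mem_leftSites]
  refine ⟨fun σ τ ⟨i, hi, h⟩ => ?_, fun σ τ σ' τ' h1 h2 h3 h4 => ?_⟩
  · rw [leftOp, Matrix.submatrix_apply, Matrix.kroneckerMap_apply,
      Matrix.one_apply_ne fun H => h ((e _ _).1 H i hi), mul_zero]
  · simp only [leftOp, Matrix.submatrix_apply, Matrix.kroneckerMap_apply, Matrix.one_apply, e]
    rw [if_pos h1, if_pos h2]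
    congr 2
    · funext i; exact h3 i (by simp [i.2])
    · funext i; exact h4 i (by simp [i.2])

theorem rightOp_actsOn (k : ℕ) (Q : Matrix ({i : Fin n // ¬ (i : ℕ) < k} → Fin d) _ ℂ) :
    ActsOn (rightSites n k) (rightOp k Q) := by
  have e : ∀ σ τ : Fin n → Fin d, (cutEquiv d n k σ).1 = (cutEquiv d n k τ).1 ↔
      ∀ i, i ∉ rightSites n k → σ i = τ i := by
    intro σ τ
    simp only [cutEquiv, Equiv.coe_fn_mk, funext_iff, Subtype.forall, mem_rightSites, not_le]
  refine ⟨fun σ τ ⟨i, hi, h⟩ => ?_, fun σ τ σ' τ' h1 h2 h3 h4 => ?_⟩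
  · rw [rightOp, Matrix.submatrix_apply, Matrix.kroneckerMap_apply,
      Matrix.one_apply_ne fun H => h ((e _ _).1 H i hi), zero_mul]
  · simp only [rightOp, Matrix.submatrix_apply, Matrix.kroneckerMap_apply, Matrix.one_apply, e]
    rw [if_pos h1, if_pos h2]
    congr 2
    · funext i; exact h3 i (mem_rightSites.2 (not_lt.1 i.2))
    · funext i; exact h4 i (mem_rightSites.2 (not_lt.1 i.2))

/-- The amplitudes of `f` as a matrix, for the cut after the first `k` spins. -/
def cutMatrix (k : ℕ) (f : State d n) : Matrix ({i : Fin n // (i : ℕ) < k} → Fin d)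
    ({i : Fin n // ¬ (i : ℕ) < k} → Fin d) ℂ :=
  Matrix.of fun a b => f (glue k a b)

theorem reducedDensity_eq (k : ℕ) (f : State d n) :
    reducedDensity f k = cutMatrix k f * (cutMatrix k f).conjTranspose := rfl

theorem op_leftOp_apply (k : ℕ) (P : Matrix ({i : Fin n // (i : ℕ) < k} → Fin d) _ ℂ)
    (f : State d n) (σ : Fin n → Fin d) :
    op (leftOp k P) f σ = (P * cutMatrix k f) (cutEquiv d n k σ).1 (cutEquiv d n k σ).2 := by
  rw [op_apply, ← (cutEquiv d n k).symm.sum_comp, Fintype.sum_prod_type, Matrix.mul_apply]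
  refine sum_congr rfl fun a _ => ?_
  rw [sum_eq_single (cutEquiv d n k σ).2]
  · simp only [leftOp, Matrix.submatrix_apply, Equiv.apply_symm_apply, Matrix.kroneckerMap_apply,
      Matrix.one_apply_eq, mul_one]
    rfl
  · intro b _ hb
    simp [leftOp, Matrix.one_apply_ne hb.symm]
  · simp

theorem op_rightOp_apply (k : ℕ) (Q : Matrix ({i : Fin n // ¬ (i : ℕ) < k} → Fin d) _ ℂ)
    (f : State d n) (σ : Fin n → Fin d) :
    op (rightOp k Q) f σ =
      (cutMatrix k f * Q.transpose) (cutEquiv d n k σ).1 (cutEquiv d n k σ).2 := by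
  rw [op_apply, ← (cutEquiv d n k).symm.sum_comp, Fintype.sum_prod_type_right, Matrix.mul_apply]
  refine sum_congr rfl fun b _ => ?_
  rw [sum_eq_single (cutEquiv d n k σ).1]
  · simp only [rightOp, Matrix.submatrix_apply, Equiv.apply_symm_apply, Matrix.kroneckerMap_apply,
      Matrix.one_apply_eq, one_mul, Matrix.transpose_apply]
    rw [mul_comm]
    rfl
  · intro a _ ha
    simp [rightOp, Matrix.one_apply_ne ha.symm]
  · simp

theorem leftOp_mul (k : ℕ) (P P' : Matrix ({i : Fin n // (i : ℕ) < k} → Fin d) _ ℂ) :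
    leftOp (d := d) k P * leftOp k P' = leftOp k (P * P') := by
  rw [leftOp, leftOp, Matrix.submatrix_mul_equiv, ← Matrix.mul_kronecker_mul, mul_one, leftOp]

theorem rightOp_mul (k : ℕ) (Q Q' : Matrix ({i : Fin n // ¬ (i : ℕ) < k} → Fin d) _ ℂ) :
    rightOp (d := d) k Q * rightOp k Q' = rightOp k (Q * Q') := by
  rw [rightOp, rightOp, Matrix.submatrix_mul_equiv, ← Matrix.mul_kronecker_mul, mul_one, rightOp]

theorem leftOp_isHermitian (k : ℕ) {P : Matrix ({i : Fin n // (i : ℕ) < k} → Fin d) _ ℂ}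
    (h : P.IsHermitian) : (leftOp (d := d) k P).IsHermitian := by
  rw [Matrix.IsHermitian, leftOp, Matrix.conjTranspose_submatrix, Matrix.conjTranspose_kronecker,
    h.eq, Matrix.conjTranspose_one]

theorem rightOp_isHermitian (k : ℕ) {Q : Matrix ({i : Fin n // ¬ (i : ℕ) < k} → Fin d) _ ℂ}
    (h : Q.IsHermitian) : (rightOp (d := d) k Q).IsHermitian := by
  rw [Matrix.IsHermitian, rightOp, Matrix.conjTranspose_submatrix, Matrix.conjTranspose_kronecker,
    h.eq, Matrix.conjTranspose_one]

theorem inner_op_of_isHermitian {X : Operator d n} (h : X.IsHermitian) (x y : State d n) :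
    inner ℂ (op X x) y = inner ℂ x (op X y) := by
  have e : (op X).adjoint = op X := by
    rw [← ContinuousLinearMap.star_eq_adjoint, op, ← map_star, Matrix.star_eq_conjTranspose, h.eq]
  rw [← ContinuousLinearMap.adjoint_inner_right, e]

theorem norm_op_le_of_projection {X : Operator d n} (h : X.IsHermitian) (h2 : X * X = X)
    (x : State d n) : ‖op X x‖ ≤ ‖x‖ := by
  have h1 := norm_op_sq X x
  rw [h.eq, h2] at h1
  have h3 := (Complex.re_le_norm _).trans (norm_inner_le_norm (𝕜 := ℂ) x (op X x))
  rw [← h1] at h3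
  nlinarith [norm_nonneg x, norm_nonneg (op X x)]

/-- `f` has Schmidt rank at most `r` across the cut after the first `k` spins. -/
def RankLE (f : State d n) (k r : ℕ) : Prop :=
  ∃ (ι : Type) (_ : Fintype ι) (u v : ι → State d n), Fintype.card ι ≤ r ∧
    (∀ j, Dep (leftSites n k) (u j)) ∧ (∀ j, Dep (rightSites n k) (v j)) ∧
    f = ∑ j, pmul (u j) (v j)

theorem norm_sq_eq_trace (k : ℕ) (f : State d n) :
    ((‖f‖ ^ 2 : ℝ) : ℂ) = (cutMatrix k f * (cutMatrix k f).conjTranspose).trace := by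
  rw [EuclideanSpace.norm_sq_eq, ← (cutEquiv d n k).symm.sum_comp, Fintype.sum_prod_type,
    Matrix.trace, Complex.ofReal_sum]
  refine sum_congr rfl fun a _ => ?_
  rw [Matrix.diag_apply, Matrix.mul_apply, Complex.ofReal_sum]
  refine sum_congr rfl fun b _ => ?_
  rw [Matrix.conjTranspose_apply, Complex.star_def, Complex.mul_conj, Complex.normSq_eq_norm_sq]
  rfl

/-- Schmidt truncation across the cut after the first `k` spins. -/
theorem exists_truncation (ψ : State d n) (hψ : ‖ψ‖ = 1) (k : ℕ) {α R s : ℝ} (h0 : 0 < α)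
    (h1 : α < 1) (hR : renyiEntropy α ψ k ≤ R) (hs : 0 < s) (hs1 : s < 1) :
    ∃ (P Q : Operator d n) (r : ℕ), ActsOn (leftSites n k) P ∧ ActsOn (rightSites n k) Q ∧
      P.IsHermitian ∧ P * P = P ∧ Q.IsHermitian ∧ Q * Q = Q ∧ op P ψ = op Q ψ ∧
      ‖ψ - op P ψ‖ ≤ s ∧ 1 ≤ r ∧ (r : ℝ) ≤ Real.exp R * s⁻¹ ^ (2 * α / (1 - α)) ∧
      ∀ f, RankLE (op P f) k r := by
  have hH := reducedDensity_isHermitian ψ k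
  have hnn : ∀ j, 0 ≤ hH.eigenvalues j := by
    open scoped ComplexOrder in
    intro j
    have : (reducedDensity ψ k).PosSemidef := by
      rw [reducedDensity_eq]; exact Matrix.posSemidef_self_mul_conjTranspose _
    exact this.eigenvalues_nonneg j
  obtain ⟨t, ht, hcard, htail⟩ := exists_threshold _ hnn h0 h1 hR hs
  obtain ⟨P, Q, hP, hPP, hQ, hQQ, hPQ, htr, U, hU⟩ :=
    exists_spectral_projections (cutMatrix k ψ) (reducedDensity_eq k ψ) hH ht
  -- `rightOp` multiplies the amplitude matrix by a transpose on the right, so the projection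
  -- inserted there is the transpose of `Q`.
  have hQT : Q.transpose.IsHermitian := by
    exact hQ.transpose
  have herr : ‖ψ - op (leftOp k P) ψ‖ ^ 2 ≤ s ^ 2 := by
    have e1 : cutMatrix k (ψ - op (leftOp k P) ψ) = (1 - P) * cutMatrix k ψ := by
      ext a b
      have := op_leftOp_apply k P ψ (glue k a b)
      have e : cutEquiv d n k (glue k a b) = (a, b) := (cutEquiv d n k).apply_symm_apply (a, b)
      rw [e] at this
      rw [Matrix.sub_mul, Matrix.one_mul]
      exact congrArg (ψ (glue k a b) - ·) this
    have e2 := norm_sq_eq_trace k (ψ - op (leftOp k P) ψ)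
    have hP1 : (1 - P).conjTranspose = 1 - P := by
      rw [Matrix.conjTranspose_sub, Matrix.conjTranspose_one, hP.eq]
    have hP2 : (1 - P) * (1 - P) = 1 - P := by
      rw [sub_mul, one_mul, mul_sub, mul_one, hPP, sub_self, sub_zero]
    have e3 : (1 - P) * cutMatrix k ψ * ((1 - P) * cutMatrix k ψ).conjTranspose
        = ((1 - P) * (cutMatrix k ψ * (cutMatrix k ψ).conjTranspose)) * (1 - P) := by
      rw [Matrix.conjTranspose_mul, hP1]; simp only [Matrix.mul_assoc]
    -- By cyclicity of the trace the squared error is `tr ((1 - P) ρ)`, the sum of the discarded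
    -- eigenvalues.
    rw [e1, e3, ← reducedDensity_eq, Matrix.trace_mul_comm, ← Matrix.mul_assoc, hP2, htr] at e2
    rw [Complex.ofReal_inj.1 e2]
    exact htail
  have herr' := abs_le_of_sq_le_sq' herr hs.le
  refine ⟨leftOp k P, rightOp k Q.transpose, (univ.filter fun j => t < hH.eigenvalues j).card,
    leftOp_actsOn k P, rightOp_actsOn k _, leftOp_isHermitian k hP, by rw [leftOp_mul, hPP],
    rightOp_isHermitian k hQT, by rw [rightOp_mul, ← Matrix.transpose_mul, hQQ], ?_, herr'.2, ?_,
    hcard, ?_⟩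
  · ext σ
    rw [op_leftOp_apply, op_rightOp_apply, Matrix.transpose_transpose, hPQ]
  -- If no eigenvalue exceeded `t`, then `P = 0` and the error would be `‖ψ‖ = 1 > s`.
  · rw [Nat.one_le_iff_ne_zero, ne_eq, card_eq_zero]
    intro hemp
    have hP0 : P = 0 := by
      ext a b; rw [hU, hemp]; simp
    have hz : op (leftOp k P) ψ = 0 := by
      ext σ
      rw [op_leftOp_apply, hP0]; simp
    rw [hz, sub_zero, hψ] at herr'
    linarith [herr'.2]
  · intro f
    refine ⟨{j // t < hH.eigenvalues j}, inferInstance,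
      fun j => WithLp.toLp 2 fun σ => U (cutEquiv d n k σ).1 j,
      fun j => WithLp.toLp 2 fun σ => ∑ a, star (U a j) * cutMatrix k f a (cutEquiv d n k σ).2,
      (Fintype.card_subtype _).le, ?_, ?_, ?_⟩
    · intro j σ τ h
      have : (cutEquiv d n k σ).1 = (cutEquiv d n k τ).1 := funext fun i => h i (by simp [i.2])
      simp only [this]
    · intro j σ τ h
      have : (cutEquiv d n k σ).2 = (cutEquiv d n k τ).2 :=
        funext fun i => h i (mem_rightSites.2 (not_lt.1 i.2))
      simp only [this]
    · ext σ
      rw [op_leftOp_apply, Matrix.mul_apply]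
      simp only [WithLp.ofLp_sum, Finset.sum_apply, pmul_apply, hU, Finset.sum_mul, Finset.mul_sum]
      rw [sum_comm]
      rw [sum_subtype (p := fun j => t < hH.eigenvalues j) (F := inferInstance) _
        (fun j => by simp)]
      simp only [mul_assoc]

/-! ### Stability of Schmidt rank bounds -/

theorem pmul_sum {ι : Type*} (s : Finset ι) (f : State d n) (g : ι → State d n) :
    pmul f (∑ j ∈ s, g j) = ∑ j ∈ s, pmul f (g j) := by
  ext σ; simp [Finset.mul_sum]

theorem slice_sum {ι : Type*} (s : Finset ι) (t : Finset (Fin n)) (τ : Fin n → Fin d)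
    (g : ι → State d n) : slice t τ (∑ j ∈ s, g j) = ∑ j ∈ s, slice t τ (g j) := by
  ext σ; simp

theorem Dep.slice {s : Finset (Fin n)} {f : State d n} (hf : Dep s f) (t : Finset (Fin n))
    (τ : Fin n → Fin d) : Dep s (slice t τ f) := fun σ σ' h => by
  refine hf _ _ fun k hk => ?_
  by_cases ht : k ∈ t <;> simp [Finset.piecewise, ht, h k hk]

theorem disjoint_leftSites_rightSites {j k : ℕ} (h : j ≤ k) :
    Disjoint (leftSites n j) (rightSites n k) := by
  rw [disjoint_left]; intro i; simp; omega

theorem leftSites_subset {j k : ℕ} (h : j ≤ k) : leftSites n j ⊆ leftSites n k := by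
  intro i; simp; omega

theorem rightSites_subset {j k : ℕ} (h : j ≤ k) : rightSites n k ⊆ rightSites n j := by
  intro i; simp; omega

theorem RankLE.mono {f : State d n} {k r r' : ℕ} (h : RankLE f k r) (hr : r ≤ r') :
    RankLE f k r' := by
  obtain ⟨ι, i, u, v, hc, h⟩ := h
  exact ⟨ι, i, u, v, hc.trans hr, h⟩

theorem RankLE.op_left {f : State d n} {j k r : ℕ} {X : Operator d n} (h : RankLE f k r)
    (hX : ActsOn (leftSites n j) X) (hj : j ≤ k) : RankLE (op X f) k r := by
  obtain ⟨ι, i, u, v, hc, hu, hv, rfl⟩ := h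
  refine ⟨ι, i, fun j => op X (u j), v, hc, fun j => hX.dep_op (leftSites_subset hj) (hu j), hv, ?_⟩
  rw [map_sum]
  exact sum_congr rfl fun j _ => hX.op_pmul (hv j) (disjoint_leftSites_rightSites hj)

theorem RankLE.slice {f : State d n} {k r : ℕ} (h : RankLE f k r) (t : Finset (Fin n))
    (τ : Fin n → Fin d) : RankLE (slice t τ f) k r := by
  obtain ⟨ι, i, u, v, hc, hu, hv, rfl⟩ := h
  refine ⟨ι, i, fun j => SpinChain.slice t τ (u j), fun j => SpinChain.slice t τ (v j), hc,
    fun j => (hu j).slice t τ, fun j => (hv j).slice t τ, ?_⟩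
  rw [slice_sum]; rfl

theorem RankLE.pmul_right {f g : State d n} {k r : ℕ} (h : RankLE f k r)
    (hg : Dep (rightSites n k) g) : RankLE (pmul g f) k r := by
  obtain ⟨ι, i, u, v, hc, hu, hv, rfl⟩ := h
  refine ⟨ι, i, u, fun j => pmul (v j) g, hc, hu, fun j => (hv j).pmul hg, ?_⟩
  rw [pmul_sum]
  refine sum_congr rfl fun j _ => ?_
  ext σ; simp; ring

theorem RankLE.pmul_left {f g : State d n} {k r : ℕ} (h : RankLE f k r)
    (hg : Dep (leftSites n k) g) : RankLE (pmul g f) k r := by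
  obtain ⟨ι, i, u, v, hc, hu, hv, rfl⟩ := h
  refine ⟨ι, i, fun j => pmul g (u j), v, hc, fun j => hg.pmul (hu j), hv, ?_⟩
  rw [pmul_sum]
  refine sum_congr rfl fun j _ => ?_
  ext σ; simp; ring

theorem RankLE.smul {f : State d n} {k r : ℕ} (h : RankLE f k r) (c : ℂ) :
    RankLE (c • f) k r := by
  have := h.pmul_left (g := WithLp.toLp 2 fun _ => c) fun _ _ _ => rfl
  exact this

/-- The amplitude that is constantly `1`. -/
def ones (d n : ℕ) : State d n := WithLp.toLp 2 fun _ => 1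

theorem ones_dep (s : Finset (Fin n)) : Dep s (ones d n) := fun _ _ _ => rfl

theorem rankLE_ones (k : ℕ) {r : ℕ} (hr : 1 ≤ r) : RankLE (ones d n) k r := by
  refine ⟨Unit, inferInstance, fun _ => ones d n, fun _ => ones d n, by simpa using hr,
    fun _ => ones_dep _, fun _ => ones_dep _, ?_⟩
  ext σ; simp [ones]

theorem pmul_ones (f : State d n) : pmul f (ones d n) = f := by
  ext σ; simp [ones]

/-- `P k` bounds the rank across `k` whatever was applied before it. The factors applied afterwards
belong to cuts `j < k`, act left of `k`, and preserve the bound; hence the order of the product. -/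
theorem rankLE_prodFrom {P : ℕ → Operator d n} {a l k r : ℕ}
    (hP : ∀ j, a < j → j ≤ a + l → ActsOn (leftSites n j) (P j))
    (hr : ∀ f, RankLE (op (P k) f) k r) (h1 : a < k) (h2 : k ≤ a + l) (f : State d n) :
    RankLE (prodFrom (fun j => op (P j)) a l f) k r := by
  have aux : ∀ l, a + l ≤ k → (∀ j, a < j → j ≤ a + l → ActsOn (leftSites n j) (P j)) →
      ∀ g, RankLE g k r → RankLE (prodFrom (fun j => op (P j)) a l g) k r := by
    intro l
    induction l with
    | zero => intro _ _ g hg; exact hg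
    | succ l ih =>
      intro hl hP g hg
      exact ih (by omega) (fun j h1 h2 => hP j h1 (by omega)) _
        (hg.op_left (hP _ (by omega) (by omega)) (by omega))
  induction l generalizing f with
  | zero => omega
  | succ l ih =>
    rcases Nat.lt_or_ge (a + l) k with h | h
    · obtain rfl : k = a + l + 1 := by omega
      exact aux l (by omega) (fun j h1 h2 => hP j h1 (by omega)) _ (hr f)
    · exact ih (fun j h1 h2 => hP j h1 (by omega)) h _

/-! ### From Schmidt ranks to matrix product states -/

/-- The span of the amplitudes on the spins after the cut `k` that occur in `f`. -/
def tailSpace (f : State d n) (k : ℕ) : Submodule ℂ (State d n) :=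
  Submodule.span ℂ (Set.range fun x => slice (rightSites n k) x f)

/-- Freezing the spins left of the cut turns every `u j` into a scalar, so all slices lie in the
span of the `v j`. -/
theorem finrank_tailSpace_le {f : State d n} {k r : ℕ} (h : RankLE f k r) :
    Module.finrank ℂ (tailSpace f k) ≤ r := by
  obtain ⟨ι, i, u, v, hc, hu, hv, rfl⟩ := h
  refine le_trans (le_trans (Submodule.finrank_mono (t := Submodule.span ℂ (Set.range v)) ?_)
    (finrank_range_le_card v)) hc
  refine Submodule.span_le.2 ?_
  rintro _ ⟨x, rfl⟩
  have : slice (rightSites n k) x (∑ j, pmul (u j) (v j)) = ∑ j, u j x • v j := by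
    rw [slice_sum]
    refine sum_congr rfl fun j _ => ?_
    ext σ
    rw [slice_apply, pmul_apply, hu j _ x fun i hi => piecewise_eq_of_notMem _ _ _
        (disjoint_left.1 (disjoint_leftSites_rightSites le_rfl) hi),
      hv j _ σ fun i hi => piecewise_eq_of_mem _ _ _ hi]
    rfl
  change slice (rightSites n k) x _ ∈ _
  rw [this]
  exact Submodule.sum_mem _ fun j _ => Submodule.smul_mem _ _ (Submodule.subset_span ⟨j, rfl⟩)

/-- Freezing the spin at the site `k` to the value `s`. -/
def siteSlice (k : Fin n) (s : Fin d) : State d n →ₗ[ℂ] State d n where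
  toFun f := WithLp.toLp 2 fun σ => f (Function.update σ k s)
  map_add' _ _ := rfl
  map_smul' _ _ := rfl

theorem siteSlice_apply (k : Fin n) (s : Fin d) (f : State d n) (σ : Fin n → Fin d) :
    siteSlice k s f σ = f (Function.update σ k s) := rfl

/-- Freezing one more spin of a slice at cut `k` gives a slice at cut `k + 1`. In chosen spanning
families, these maps are the matrices of the matrix product state. -/
theorem siteSlice_mem_tailSpace {f v : State d n} (k : Fin n) (s : Fin d)
    (hv : v ∈ tailSpace f k) : siteSlice k s v ∈ tailSpace f (k + 1) := by
  have : tailSpace f k ≤ (tailSpace f (k + 1)).comap (siteSlice k s) := by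
    refine Submodule.span_le.2 ?_
    rintro _ ⟨x, rfl⟩
    refine Submodule.subset_span ⟨Function.update x k s, ?_⟩
    ext σ
    rw [siteSlice_apply, slice_apply, slice_apply]
    refine congrArg f (funext fun i => ?_)
    rcases eq_or_ne i k with rfl | h
    · simp [Finset.piecewise]
    · have h' : (i : ℕ) ≠ k := fun e => h (Fin.ext e)
      have : (k : ℕ) + 1 ≤ i ↔ (k : ℕ) ≤ i := by omega
      simp [Finset.piecewise, h, this]
  exact this hv

/-- A state with Schmidt rank at most `r` across every cut is a matrix product state with bond
dimension at most `r`. -/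
theorem exists_mps {f : State d n} (hn : 0 < n) (hf : f ≠ 0) {r : ℕ} (hr : 1 ≤ r)
    (h : ∀ k, RankLE f k r) : ∃ M : MPS d n, M.state = f ∧ M.bondDim ≤ r := by
  obtain ⟨σ₀, hσ₀⟩ : ∃ σ, f σ ≠ 0 := by
    by_contra! H
    exact hf (by ext σ; exact H σ)
  -- The families at the two ends are fixed to `f` and to the constant `1`, so that the full product
  -- is the amplitude of `f` with no boundary vectors; in between, any basis serves.
  have hV : ∀ k : Fin (n + 1), ∃ m : ℕ, 0 < m ∧ m ≤ r ∧ (k = 0 → m = 1) ∧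
      (k = Fin.last n → m = 1) ∧ ∃ v : Fin m → State d n,
        Submodule.span ℂ (Set.range v) = tailSpace f k ∧ (k = 0 → ∀ j, v j = f) ∧
        (k = Fin.last n → ∀ j, v j = ones d n) := by
    intro k
    have h0n : (0 : Fin (n + 1)) ≠ Fin.last n := by
      rw [ne_eq, Fin.ext_iff]; simp; omega
    by_cases hk0 : k = 0
    · subst hk0
      refine ⟨1, one_pos, hr, fun _ => rfl, fun _ => rfl, fun _ => f, ?_, fun _ _ => rfl,
        fun h => absurd h h0n⟩
      have e : (fun x => slice (rightSites n 0) x f) = fun _ => f := by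
        funext x; ext σ
        exact congrArg f (funext fun i => by simp [Finset.piecewise])
      have : Nonempty (Fin n → Fin d) := ⟨σ₀⟩
      rw [tailSpace, Fin.val_zero, e, Set.range_const, Set.range_const]
    by_cases hkn : k = Fin.last n
    · subst hkn
      refine ⟨1, one_pos, hr, fun _ => rfl, fun _ => rfl, fun _ => ones d n, ?_,
        fun h => absurd h hk0, fun _ _ => rfl⟩
      have e : ∀ x, slice (rightSites n n) x f = f x • ones d n := by
        intro x; ext σ
        have : (rightSites n n).piecewise σ x = x :=
          funext fun i => by simp [Finset.piecewise]
        rw [slice_apply, this]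
        simp [ones]
      rw [tailSpace, Fin.val_last, Set.range_const]
      apply le_antisymm
      · rw [Submodule.span_singleton_le_iff_mem]
        have : ones d n = (f σ₀)⁻¹ • slice (rightSites n n) σ₀ f := by
          rw [e, smul_smul, inv_mul_cancel₀ hσ₀, one_smul]
        rw [this]
        exact Submodule.smul_mem _ _ (Submodule.subset_span ⟨σ₀, rfl⟩)
      · refine Submodule.span_le.2 ?_
        rintro _ ⟨x, rfl⟩
        simp only [e]
        exact Submodule.smul_mem _ _ (Submodule.mem_span_singleton_self _)
    · refine ⟨Module.finrank ℂ (tailSpace f k), ?_, finrank_tailSpace_le (h k),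
        fun h => absurd h hk0, fun h => absurd h hkn,
        fun j => (Module.finBasis ℂ (tailSpace f k) j : State d n), ?_,
        fun h => absurd h hk0, fun h => absurd h hkn⟩
      · have hmem : slice (rightSites n k) σ₀ f ∈ tailSpace f k := Submodule.subset_span ⟨σ₀, rfl⟩
        have hne : slice (rightSites n k) σ₀ f ≠ 0 := by
          intro h0
          apply hσ₀
          have := congrArg (fun g : State d n => g σ₀) h0
          rwa [slice_apply, piecewise_same] at this
        have : Nontrivial (tailSpace f k) :=
          ⟨⟨⟨_, hmem⟩, 0, fun h => hne (congrArg Subtype.val h)⟩⟩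
        exact Module.finrank_pos
      · have := congrArg (Submodule.map (tailSpace f k).subtype)
          (Module.finBasis ℂ (tailSpace f k)).span_eq
        rw [Submodule.map_span, ← Set.range_comp, Submodule.map_top, Submodule.range_subtype] at this
        exact this
  choose D hD0 hDr hDfirst hDlast v hspan hfirst hlast using hV
  have hstep : ∀ (k : Fin n) (s : Fin d) (j : Fin (D k.castSucc)), ∃ c : Fin (D k.succ) → ℂ,
      ∑ i, c i • v k.succ i = siteSlice k s (v k.castSucc j) := by
    intro k s j
    rw [← Submodule.mem_span_range_iff_exists_fun, hspan]
    have hm : v k.castSucc j ∈ tailSpace f (k : ℕ) := by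
      have := hspan k.castSucc
      rw [Fin.val_castSucc] at this
      rw [← this]
      exact Submodule.subset_span ⟨j, rfl⟩
    simpa using siteSlice_mem_tailSpace k s hm
  choose A hA using hstep
  let M : MPS d n := ⟨D, hD0, hDfirst 0 rfl, hDlast _ rfl, fun k s => Matrix.of (A k s)⟩
  -- Invariant: the row vector of the first `k` sites holds coordinates of the remaining tail of
  -- `f`.
  have key : ∀ (σ : Fin n → Fin d) (k : Fin (n + 1)),
      f σ = ∑ j : Fin (D k), M.partialProduct σ k ⟨0, hD0 0⟩ j * v k j σ := by
    intro σ k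
    induction k using Fin.induction with
    | zero =>
      simp only [hfirst 0 rfl]
      have : M.partialProduct σ 0 = 1 := rfl
      rw [this, sum_eq_single (⟨0, hD0 0⟩ : Fin (D 0))]
      · rw [Matrix.one_apply_eq, one_mul]
      · intro b _ hb
        rw [Matrix.one_apply_ne hb.symm, zero_mul]
      · simp
    | succ k ih =>
      have hp : M.partialProduct σ k.succ = M.partialProduct σ k.castSucc * M.A k (σ k) := by
        simp [MPS.partialProduct, Fin.induction_succ]
      have hv : ∀ j, v k.castSucc j σ = ∑ i, A k (σ k) j i * v k.succ i σ := by
        intro j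
        have h1 : v k.castSucc j σ = siteSlice k (σ k) (v k.castSucc j) σ := by
          rw [siteSlice_apply, Function.update_eq_self]
        rw [h1, ← hA]
        simp
      rw [ih, hp]
      simp only [hv, Finset.mul_sum]
      rw [sum_comm]
      refine sum_congr rfl fun i _ => ?_
      rw [Matrix.mul_apply, Finset.sum_mul]
      exact sum_congr rfl fun j _ => (mul_assoc _ _ _).symm
  refine ⟨M, ?_, Finset.sup_le fun k _ => hDr k⟩
  ext σ
  rw [key σ (Fin.last n)]
  simp only [hlast _ rfl]
  have : Subsingleton (Fin (D (Fin.last n))) := by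
    rw [hDlast _ rfl]; infer_instance
  rw [Fintype.sum_subsingleton _ (⟨0, hD0 _⟩ : Fin (D (Fin.last n)))]
  simp [ones, MPS.state]

/-! ### Energy of block product states -/

/-- The bonds whose two sites both lie in `[a, b)`. -/
def bondsIn (n a b : ℕ) : Finset (Fin (n - 1)) := univ.filter fun i => a ≤ (i : ℕ) ∧ (i : ℕ) + 1 < b

theorem mem_bondsIn {a b : ℕ} {i : Fin (n - 1)} :
    i ∈ bondsIn n a b ↔ a ≤ (i : ℕ) ∧ (i : ℕ) + 1 < b := by simp [bondsIn]

theorem card_bondsIn_le (n a b : ℕ) : (bondsIn n a b).card ≤ b - a := by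
  rw [← Nat.card_Ico a b]
  refine card_le_card_of_injOn (fun i => (i : ℕ)) (fun i hi => ?_) fun i _ j _ h => Fin.ext h
  rw [mem_coe, mem_bondsIn] at hi
  rw [mem_coe, mem_Ico]
  change a ≤ (i : ℕ) ∧ (i : ℕ) < b
  omega

/-- Beyond the bonds inside the two intervals there is at most one more, joining the sites `a - 1`
and `a`; it accounts for `c`. -/
theorem sum_bondsIn_le {a b : ℕ} (ha : a < b) {F F₁ F₂ : Fin (n - 1) → ℝ} {c : ℝ}
    (hc : 0 ≤ c) (h1 : ∀ i ∈ bondsIn n 0 a, F i ≤ F₁ i) (h2 : ∀ i ∈ bondsIn n a b, F i ≤ F₂ i)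
    (h3 : ∀ i, F i ≤ c) :
    ∑ i ∈ bondsIn n 0 b, F i ≤ ∑ i ∈ bondsIn n 0 a, F₁ i + c + ∑ i ∈ bondsIn n a b, F₂ i := by
  have e : bondsIn n 0 b ⊆ bondsIn n 0 a ∪ univ.filter (fun i => (i : ℕ) + 1 = a) ∪ bondsIn n a b := by
    intro i
    simp only [mem_union, mem_bondsIn, mem_filter, mem_univ, true_and]
    omega
  have d1 : Disjoint (bondsIn n 0 a ∪ univ.filter (fun i => (i : ℕ) + 1 = a)) (bondsIn n a b) := by
    rw [disjoint_left]; intro i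
    simp only [mem_union, mem_bondsIn, mem_filter, mem_univ, true_and]
    omega
  have d2 : Disjoint (bondsIn n 0 a) (univ.filter (fun i => (i : ℕ) + 1 = a)) := by
    rw [disjoint_left]; intro i
    simp only [mem_bondsIn, mem_filter, mem_univ, true_and]
    omega
  have e' : bondsIn n 0 a ∪ univ.filter (fun i => (i : ℕ) + 1 = a) ∪ bondsIn n a b ⊆
      (bondsIn n 0 b) ∪ univ.filter (fun i => (i : ℕ) + 1 = a) := by
    intro i
    simp only [mem_union, mem_bondsIn, mem_filter, mem_univ, true_and]
    omega
  -- `F` may be negative; its positive part allows the index set to be enlarged to all bonds at the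
  -- end.
  have e3 : ∑ i ∈ univ.filter (fun i : Fin (n - 1) => (i : ℕ) + 1 = a), max (F i) 0 ≤ c := by
    have hcard : (univ.filter (fun i : Fin (n - 1) => (i : ℕ) + 1 = a)).card ≤ 1 := by
      rw [card_le_one]
      intro i hi j hj
      simp only [mem_filter, mem_univ, true_and] at hi hj
      exact Fin.ext (by omega)
    refine (sum_le_card_nsmul _ _ c fun i _ => max_le (h3 i) hc).trans ?_
    rw [nsmul_eq_mul]
    exact mul_le_of_le_one_left hc (by exact_mod_cast hcard)
  have key : ∑ i ∈ bondsIn n 0 b, F i ≤ ∑ i ∈ bondsIn n 0 b,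
      ((if i ∈ bondsIn n 0 a then F₁ i else 0) + (if (i : ℕ) + 1 = a then max (F i) 0 else 0) +
        if i ∈ bondsIn n a b then F₂ i else 0) := by
    refine sum_le_sum fun i hi => ?_
    rcases mem_union.1 (e hi) with h | h
    · rcases mem_union.1 h with h' | h'
      · have n1 : ¬ (i : ℕ) + 1 = a := by rw [mem_bondsIn] at h'; omega
        have n2 := disjoint_left.1 d1 h
        simp only [h', n1, n2, if_true, if_false]
        linarith [h1 i h']
      · have n1 := disjoint_right.1 d2 h'
        have n2 := disjoint_left.1 d1 h
        simp only [n1, n2, (mem_filter.1 h').2, if_true, if_false]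
        linarith [le_max_left (F i) 0]
    · have n1 := disjoint_right.1 d1 h
      rw [mem_union, not_or] at n1
      have n2 : ¬ (i : ℕ) + 1 = a := by simpa using n1.2
      simp only [n1.1, n2, h, if_true, if_false]
      linarith [h2 i h]
  refine key.trans ?_
  rw [sum_add_distrib, sum_add_distrib, sum_ite_mem, sum_ite_mem, ← sum_filter]
  have i1 : bondsIn n 0 b ∩ bondsIn n 0 a = bondsIn n 0 a := by
    ext i; simp only [mem_inter, mem_bondsIn]; omega
  have i2 : bondsIn n 0 b ∩ bondsIn n a b = bondsIn n a b := by
    ext i; simp only [mem_inter, mem_bondsIn]; omega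
  rw [i1, i2]
  gcongr
  refine le_trans ?_ e3
  exact sum_le_sum_of_subset_of_nonneg (filter_subset_filter _ (subset_univ _))
    fun i _ _ => le_max_right _ _

/-- A state with square-root bond terms `G`, and projections as provided by Schmidt truncation at
every cut, with error `s` and rank `r`. -/
structure TruncData (ψ : State d n) (G : Fin (n - 1) → Operator d n) (P Q : ℕ → Operator d n)
    (s : ℝ) (r : ℕ) : Prop where
  norm_eq : ‖ψ‖ = 1
  s_pos : 0 < s
  s_le : s ≤ 1 / 8
  G_actsOn : ∀ i, ActsOn (bondSites i) (G i)
  norm_G_le : ∀ i f, ‖op (G i) f‖ ^ 2 ≤ 2 * ‖f‖ ^ 2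
  one_le_r : 1 ≤ r
  P_actsOn : ∀ k, 1 ≤ k → k < n → ActsOn (leftSites n k) (P k)
  Q_actsOn : ∀ k, 1 ≤ k → k < n → ActsOn (rightSites n k) (Q k)
  P_herm : ∀ k, 1 ≤ k → k < n → (P k).IsHermitian
  P_sq : ∀ k, 1 ≤ k → k < n → P k * P k = P k
  Q_herm : ∀ k, 1 ≤ k → k < n → (Q k).IsHermitian
  Q_sq : ∀ k, 1 ≤ k → k < n → Q k * Q k = Q k
  P_eq_Q : ∀ k, 1 ≤ k → k < n → op (P k) ψ = op (Q k) ψ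
  err : ∀ k, 1 ≤ k → k < n → ‖ψ - op (P k) ψ‖ ≤ s
  rank : ∀ k, 1 ≤ k → k < n → ∀ f, RankLE (op (P k) f) k r

/-- Averaging: the `G i` act inside `t` and commute with slicing, so both sides summed over `τ` are
the same multiple of the two sides of `he`. Not every nonzero slice can violate the inequality. -/
theorem exists_slice_energy_le {ψ' : State d n} {G : Fin (n - 1) → Operator d n}
    (hG : ∀ i, ActsOn (bondSites i) (G i)) {t : Finset (Fin n)} {B : Finset (Fin (n - 1))}
    (hB : ∀ i ∈ B, bondSites i ⊆ t) (h0 : ψ' ≠ 0) {e : ℝ}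
    (he : ∑ i ∈ B, ‖op (G i) ψ'‖ ^ 2 ≤ e * ‖ψ'‖ ^ 2) :
    ∃ τ, slice t τ ψ' ≠ 0 ∧
      ∑ i ∈ B, ‖op (G i) (slice t τ ψ')‖ ^ 2 ≤ e * ‖slice t τ ψ'‖ ^ 2 := by
  by_contra! H
  have h1 : ∑ τ, ∑ i ∈ B, ‖op (G i) (slice t τ ψ')‖ ^ 2 ≤ ∑ τ, e * ‖slice t τ ψ'‖ ^ 2 := by
    rw [sum_comm, ← Finset.mul_sum, sum_norm_slice]
    have : ∀ i ∈ B, ∑ τ, ‖op (G i) (slice t τ ψ')‖ ^ 2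
        = Fintype.card (Fin n → Fin d) * ‖op (G i) ψ'‖ ^ 2 := by
      intro i hi
      rw [← sum_norm_slice t]
      exact sum_congr rfl fun τ _ => by rw [(hG i).op_slice (hB i hi)]
    rw [sum_congr rfl this, ← Finset.mul_sum]
    nlinarith [Nat.cast_nonneg (α := ℝ) (Fintype.card (Fin n → Fin d))]
  obtain ⟨σ, hσ⟩ : ∃ σ, ψ' σ ≠ 0 := by
    by_contra! H
    exact h0 (by ext σ; exact H σ)
  have hne : slice t σ ψ' ≠ 0 := by
    intro h
    have := congrArg (fun g : State d n => g σ) h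
    rw [slice_apply, piecewise_same] at this
    exact hσ this
  refine absurd h1 (not_le.2 (sum_lt_sum (fun τ _ => ?_) ⟨σ, mem_univ _, H σ hne⟩))
  by_cases hz : slice t τ ψ' = 0
  · simp [hz]
  · exact (H τ hz).le

namespace TruncData

variable {ψ : State d n} {G : Fin (n - 1) → Operator d n} {P Q : ℕ → Operator d n} {s : ℝ} {r : ℕ}

theorem norm_G_le' (D : TruncData ψ G P Q s r) (i : Fin (n - 1)) {f : State d n} {c : ℝ}
    (hc : 0 ≤ c) (hf : 2 * ‖f‖ ^ 2 ≤ c ^ 2) : ‖op (G i) f‖ ≤ c :=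
  abs_le_of_sq_le_sq' ((D.norm_G_le i f).trans hf) hc |>.2

theorem exists_block (D : TruncData ψ G P Q s r) {a b : ℕ} (hab : a < b) (hb : b ≤ n)
    (hl : ((b - a : ℕ) : ℝ) * s ≤ 2) :
    ∃ g : State d n, g ≠ 0 ∧ Dep (leftSites n b ∩ rightSites n a) g ∧
      (∀ k, a < k → k < b → RankLE g k r) ∧
      ∑ i ∈ bondsIn n a b, ‖op (G i) g‖ ^ 2 ≤
        (∑ i ∈ bondsIn n a b, ‖op (G i) ψ‖ ^ 2 + 30 * s * (b - a : ℕ)) * ‖g‖ ^ 2 := by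
  have hs := D.s_pos
  have hs8 := D.s_le
  obtain ⟨l, rfl⟩ : ∃ l, b = a + l + 1 := ⟨b - a - 1, by omega⟩
  have hr : ∀ k, a < k → k ≤ a + l → 1 ≤ k ∧ k < n := fun k h1 h2 => by omega
  set ψ' := prodFrom (fun k => op (P k)) a l ψ with hψ'
  set m : ℝ := ((a + l + 1 - a : ℕ) : ℝ) with hm
  have hml : m = l + 1 := by
    rw [hm]
    have : a + l + 1 - a = l + 1 := by omega
    rw [this]; push_cast; rfl
  have hP : ∀ k, a < k → k ≤ a + l → ∀ x, ‖op (P k) x‖ ≤ ‖x‖ := fun k h1 h2 =>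
    norm_op_le_of_projection (D.P_herm k (hr k h1 h2).1 (hr k h1 h2).2)
      (D.P_sq k (hr k h1 h2).1 (hr k h1 h2).2)
  have hQ : ∀ k, a < k → k ≤ a + l → ∀ x, ‖op (Q k) x‖ ≤ ‖x‖ := fun k h1 h2 =>
    norm_op_le_of_projection (D.Q_herm k (hr k h1 h2).1 (hr k h1 h2).2)
      (D.Q_sq k (hr k h1 h2).1 (hr k h1 h2).2)
  have hPQ : ∀ k, a < k → k ≤ a + l → op (P k) ψ = op (Q k) ψ := fun k h1 h2 =>
    D.P_eq_Q k (hr k h1 h2).1 (hr k h1 h2).2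
  have hc : ∀ k, a < k → k ≤ a + l → ∀ j, a < j → j ≤ k → Commute (op (Q k)) (op (P j)) :=
    fun k h1 h2 j h3 h4 => (D.Q_actsOn k (hr k h1 h2).1 (hr k h1 h2).2).op_commute
      (D.P_actsOn j (hr j h3 (by omega)).1 (hr j h3 (by omega)).2)
      (disjoint_leftSites_rightSites h4).symm
  have herr : ∀ k, a < k → k ≤ a + l → ‖ψ - op (P k) ψ‖ ≤ s := fun k h1 h2 =>
    D.err k (hr k h1 h2).1 (hr k h1 h2).2
  -- The overlap loss is at most `l s² ≤ 2s`, since the block length times `s` is at most 2; then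
  -- square.
  have hnorm : 1 - 4 * s ≤ ‖ψ'‖ ^ 2 := by
    have h1 := le_re_inner_prodFrom (P := fun k => op (P k)) (Q := fun k => op (Q k)) (a := a)
      (l := l) (ε := s ^ 2) D.norm_eq hP
      (fun k h1 h2 => inner_op_of_isHermitian (D.Q_herm k (hr k h1 h2).1 (hr k h1 h2).2))
      (fun k h1 h2 => by
        rw [op, ← map_mul, D.Q_sq k (hr k h1 h2).1 (hr k h1 h2).2]) hPQ hc
      (fun k h1 h2 => by
        have := herr k h1 h2
        gcongr)
    have h2 := (Complex.re_le_norm _).trans (norm_inner_le_norm (𝕜 := ℂ) ψ ψ')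
    rw [D.norm_eq, one_mul] at h2
    have h3 : (l : ℝ) * s ^ 2 ≤ 2 * s := by
      have : (l : ℝ) * s ≤ 2 := by nlinarith
      nlinarith
    have h4 : 1 - 2 * s ≤ ‖ψ'‖ := by linarith
    nlinarith
  have hne : ψ' ≠ 0 := by
    intro h
    rw [h, norm_zero] at hnorm
    linarith
  -- `‖G χ‖ ≤ √2 s ≤ 2s` for a truncation error `χ`, and `‖G ψ‖ ≤ √2 ≤ 3/2`. Squaring adds at most
  -- `6s + 4s² ≤ 7s`.
  have henergy : ∀ i, ‖op (G i) ψ'‖ ^ 2 ≤ ‖op (G i) ψ‖ ^ 2 + 7 * s := by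
    intro i
    have h1 : ‖op (G i) ψ'‖ ≤ ‖op (G i) ψ‖ + 2 * s := by
      refine norm_apply_prodFrom_le (P := fun k => op (P k)) (Q := fun k => op (Q k)) (i := i)
        (by positivity) hP hQ hPQ hc
        (fun k h1 h2 h3 => (D.G_actsOn i).op_commute
          (D.P_actsOn k (hr k h1 h2).1 (hr k h1 h2).2) ?_)
        (fun k h1 h2 h3 => (D.G_actsOn i).op_commute
          (D.Q_actsOn k (hr k h1 h2).1 (hr k h1 h2).2) ?_)
        (fun k h1 h2 => D.norm_G_le' i (by positivity) ?_)
      · rw [disjoint_left]; intro j; rw [mem_bondSites, mem_leftSites]; omega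
      · rw [disjoint_left]; intro j; rw [mem_bondSites, mem_rightSites]; omega
      · nlinarith [herr k h1 h2, norm_nonneg (ψ - op (P k) ψ)]
    have h2 : ‖op (G i) ψ‖ ≤ 3 / 2 := D.norm_G_le' i (by norm_num) (by rw [D.norm_eq]; norm_num)
    nlinarith [norm_nonneg (op (G i) ψ'), norm_nonneg (op (G i) ψ)]
  set B := bondsIn n a (a + l + 1) with hB
  set X := ∑ i ∈ B, ‖op (G i) ψ‖ ^ 2 with hX
  have hcard : (B.card : ℝ) ≤ m := Nat.cast_le.2 (card_bondsIn_le n a (a + l + 1))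
  have hX0 : 0 ≤ X := sum_nonneg fun i _ => sq_nonneg _
  have hX2 : X ≤ 2 * m := by
    have : X ≤ B.card • (2 : ℝ) := sum_le_card_nsmul _ _ _ fun i _ => by
      have := D.norm_G_le i ψ
      rwa [D.norm_eq, one_pow, mul_one] at this
    rw [nsmul_eq_mul] at this
    linarith
  -- Normalising by `‖ψ'‖² ≥ 1 - 4s` costs `4sX ≤ 8sm` and `120 s² m ≤ 15sm`; the constant 30
  -- satisfies `30 - 8 - 15 = 7`.
  have hS : ∑ i ∈ B, ‖op (G i) ψ'‖ ^ 2 ≤ (X + 30 * s * m) * ‖ψ'‖ ^ 2 := by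
    have h1 : ∑ i ∈ B, ‖op (G i) ψ'‖ ^ 2 ≤ X + 7 * s * m := by
      refine (sum_le_sum fun i _ => henergy i).trans ?_
      rw [sum_add_distrib, sum_const, nsmul_eq_mul]
      nlinarith
    have hm0 : 0 ≤ m := by rw [hm]; positivity
    have hsm : 0 ≤ s * m := by positivity
    have h2 : (X + 30 * s * m) * (1 - 4 * s) ≤ (X + 30 * s * m) * ‖ψ'‖ ^ 2 :=
      mul_le_mul_of_nonneg_left hnorm (by nlinarith)
    refine h1.trans (le_trans ?_ h2)
    have h3 : s * X ≤ s * (2 * m) := mul_le_mul_of_nonneg_left hX2 hs.le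
    have h4 : s * (s * m) ≤ 1 / 8 * (s * m) := mul_le_mul_of_nonneg_right hs8 hsm
    nlinarith
  obtain ⟨τ, hτ0, hτ⟩ := exists_slice_energy_le D.G_actsOn
    (t := leftSites n (a + l + 1) ∩ rightSites n a) (B := B) (fun i hi j hj => by
      rw [hB, mem_bondsIn] at hi
      rw [mem_bondSites] at hj
      rw [mem_inter, mem_leftSites, mem_rightSites]
      omega) hne hS
  refine ⟨_, hτ0, slice_dep _ _ _, fun k h1 h2 => ?_, hτ⟩
  have h2' : k ≤ a + l := by omega
  exact (rankLE_prodFrom (fun j h3 h4 => D.P_actsOn j (hr j h3 h4).1 (hr j h3 h4).2)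
    (D.rank k (hr k h1 h2').1 (hr k h1 h2').2) h1 h2' ψ).slice _ _

/-- At a cut outside the interior of the block, `g` depends on one side only and has rank at most 1.
-/
theorem rankLE_of_block {g : State d n} {a b : ℕ} (hr : 1 ≤ r)
    (hg : Dep (leftSites n b ∩ rightSites n a) g) (h : ∀ k, a < k → k < b → RankLE g k r) (k : ℕ) :
    RankLE g k r := by
  rcases Nat.lt_or_ge a k with h1 | h1
  · rcases Nat.lt_or_ge k b with h2 | h2
    · exact h k h1 h2
    · rw [← pmul_ones g]
      exact (rankLE_ones k hr).pmul_left
        (hg.mono (inter_subset_left.trans (leftSites_subset h2)))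
  · rw [← pmul_ones g]
    exact (rankLE_ones k hr).pmul_right
      (hg.mono (inter_subset_right.trans (rightSites_subset h1)))

/-- Blocks of length `L` are split off from the right until at most `L` sites remain. Every junction
costs at most `2 ≤ 2 s L`, which raises the constant from 30 to 32. -/
theorem exists_prefix (D : TruncData ψ G P Q s r) {L : ℕ} (hL1 : 1 ≤ (L : ℝ) * s)
    (hL2 : (L : ℝ) * s ≤ 2) (b : ℕ) (hb : b ≤ n) (hb0 : 0 < b) :
    ∃ f : State d n, f ≠ 0 ∧ Dep (leftSites n b) f ∧ (∀ k, RankLE f k r) ∧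
      ∑ i ∈ bondsIn n 0 b, ‖op (G i) f‖ ^ 2 ≤
        (∑ i ∈ bondsIn n 0 b, ‖op (G i) ψ‖ ^ 2 + 32 * s * b) * ‖f‖ ^ 2 := by
  have hs := D.s_pos
  induction b using Nat.strong_induction_on with
  | _ b ih =>
    rcases Nat.lt_or_ge L b with hbL | hbL
    · have hL0 : 0 < L := by
        rcases Nat.eq_zero_or_pos L with h | h
        · rw [h] at hL1; norm_num at hL1
        · exact h
      obtain ⟨a, rfl⟩ : ∃ a, b = a + L := ⟨b - L, by omega⟩
      obtain ⟨f, hf0, hfD, hfR, hfE⟩ := ih a (by omega) (by omega) (by omega)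
      have hsub : a + L - a = L := by omega
      obtain ⟨g, hg0, hgD, hgR, hgE⟩ := D.exists_block (a := a) (b := a + L) (by omega) hb
        (by rw [hsub]; exact hL2)
      rw [hsub] at hgE
      have hgD' := hgD.mono inter_subset_right
      have hdisj := disjoint_leftSites_rightSites (n := n) (le_refl a)
      have hN := card_mul_norm_pmul hfD hgD' hdisj
      set N : ℝ := (Fintype.card (Fin n → Fin d) : ℝ) with hNdef
      have hNnn : 0 ≤ N := Nat.cast_nonneg _
      have hfg : 0 < ‖f‖ ^ 2 * ‖g‖ ^ 2 := by
        have := norm_pos_iff.2 hf0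
        have := norm_pos_iff.2 hg0
        positivity
      have hNpos : 0 < N := by
        rcases hNnn.eq_or_lt with h | h
        · rw [← hN, ← h, zero_mul] at hfg; exact absurd hfg (lt_irrefl _)
        · exact h
      refine ⟨pmul f g, ?_, (hfD.mono (leftSites_subset (by omega))).pmul
        (hgD.mono inter_subset_left), fun k => ?_, ?_⟩
      · intro h
        rw [h, norm_zero] at hN
        rw [← hN] at hfg
        norm_num at hfg
      · rcases Nat.lt_or_ge a k with h | h
        · exact (rankLE_of_block D.one_le_r hgD hgR k).pmul_left
            (hfD.mono (leftSites_subset (by omega)))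
        · rw [pmul_comm]
          exact (hfR k).pmul_right (hgD'.mono (rightSites_subset h))
      -- All terms are multiplied by `N`, so that `card_mul_norm_pmul` splits them into norms of `f`
      -- and `g`.
      · have key := sum_bondsIn_le (n := n) (a := a) (b := a + L) (by omega)
          (F := fun i => N * ‖op (G i) (pmul f g)‖ ^ 2)
          (F₁ := fun i => ‖op (G i) f‖ ^ 2 * ‖g‖ ^ 2) (F₂ := fun i => ‖op (G i) g‖ ^ 2 * ‖f‖ ^ 2)
          (c := 2 * (‖f‖ ^ 2 * ‖g‖ ^ 2)) (by positivity) (fun i hi => ?_) (fun i hi => ?_)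
          (fun i => ?_)
        · rw [← Finset.mul_sum, ← Finset.sum_mul, ← Finset.sum_mul] at key
          -- The energy of `ψ` on the junction bond can be discarded because `1 + H_i ≥ 0`.
          have hXX : ∑ i ∈ bondsIn n 0 a, ‖op (G i) ψ‖ ^ 2 +
              ∑ i ∈ bondsIn n a (a + L), ‖op (G i) ψ‖ ^ 2 ≤
              ∑ i ∈ bondsIn n 0 (a + L), ‖op (G i) ψ‖ ^ 2 := by
            rw [← sum_union]
            · refine sum_le_sum_of_subset_of_nonneg ?_ fun i _ _ => sq_nonneg _
              intro i
              rw [mem_union, mem_bondsIn, mem_bondsIn, mem_bondsIn]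
              omega
            · rw [disjoint_left]; intro i
              rw [mem_bondsIn, mem_bondsIn]
              omega
          refine le_of_mul_le_mul_left ?_ hNpos
          have e : N * ((∑ i ∈ bondsIn n 0 (a + L), ‖op (G i) ψ‖ ^ 2 + 32 * s * (a + L : ℕ)) *
              ‖pmul f g‖ ^ 2) = (∑ i ∈ bondsIn n 0 (a + L), ‖op (G i) ψ‖ ^ 2 +
                32 * s * (a + L : ℕ)) * (‖f‖ ^ 2 * ‖g‖ ^ 2) := by
            rw [← hN]; ring
          rw [e]
          refine key.trans ?_
          have k1 := mul_le_mul_of_nonneg_right hfE (sq_nonneg ‖g‖)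
          have k2 := mul_le_mul_of_nonneg_right hgE (sq_nonneg ‖f‖)
          have k3 := mul_le_mul_of_nonneg_right hXX hfg.le
          have k4 := mul_le_mul_of_nonneg_right hL1 hfg.le
          push_cast
          nlinarith
        · have e1 : op (G i) (pmul f g) = pmul (op (G i) f) g := by
            refine (D.G_actsOn i).op_pmul hgD' ?_
            rw [mem_bondsIn] at hi
            rw [disjoint_left]; intro j; rw [mem_bondSites, mem_rightSites]; omega
          have e2 : Dep (leftSites n a) (op (G i) f) := by
            refine (D.G_actsOn i).dep_op ?_ hfD
            rw [mem_bondsIn] at hi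
            intro j; rw [mem_bondSites, mem_leftSites]; omega
          simp only [e1]
          exact (card_mul_norm_pmul e2 hgD' hdisj).le
        · have e1 : op (G i) (pmul f g) = pmul f (op (G i) g) := by
            rw [pmul_comm f, pmul_comm f]
            refine (D.G_actsOn i).op_pmul hfD ?_
            rw [mem_bondsIn] at hi
            rw [disjoint_left]; intro j; rw [mem_bondSites, mem_leftSites]; omega
          have e2 : Dep (rightSites n a) (op (G i) g) := by
            refine (D.G_actsOn i).dep_op ?_ hgD'
            rw [mem_bondsIn] at hi
            intro j; rw [mem_bondSites, mem_rightSites]; omega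
          simp only [e1]
          rw [mul_comm (‖op (G i) g‖ ^ 2)]
          exact (card_mul_norm_pmul hfD e2 hdisj).le
        · have := mul_le_mul_of_nonneg_left (D.norm_G_le i (pmul f g)) hNnn
          rw [← hN]
          linarith
    · obtain ⟨g, hg0, hgD, hgR, hgE⟩ := D.exists_block (a := 0) (b := b) hb0 hb (by
        refine le_trans ?_ hL2
        rw [Nat.sub_zero]
        have : (b : ℝ) ≤ L := by exact_mod_cast hbL
        gcongr)
      refine ⟨g, hg0, hgD.mono inter_subset_left, rankLE_of_block D.one_le_r hgD hgR,
        hgE.trans ?_⟩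
      rw [Nat.sub_zero]
      gcongr
      norm_num

end TruncData

/-! ### Energies and the main theorem -/

theorem expectation_hamiltonian (h : Fin (n - 1) → TwoSite d) (f : State d n) :
    expectation (hamiltonian h) f = ∑ i, (inner ℂ f (op (onBond i (h i)) f)).re := by
  rw [expectation, hamiltonian, map_sum, _root_.sum_apply, inner_sum, Complex.re_sum]

theorem IsGroundState.expectation_eq {H : Operator d n} {ψ : State d n} (hψ : IsGroundState H ψ) :
    expectation H ψ = groundEnergy H := by
  rw [expectation, hψ.2, inner_smul_right, inner_self_eq_norm_sq_to_K, hψ.1]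
  simp

theorem bondsIn_univ (hn : 1 ≤ n) : bondsIn n 0 n = univ := by
  ext i
  have := i.2
  simp only [mem_bondsIn, mem_univ, iff_true]
  omega

end SpinChain

theorem mainTheorem3 (d : ℕ) :
    ∃ C : ℝ, 0 < C ∧
      ∀ (n : ℕ) (_ : 2 ≤ n) (h : Fin (n - 1) → SpinChain.TwoSite d)
        (_ : ∀ i, (h i).IsHermitian) (_ : ∀ i, SpinChain.opNorm (h i) ≤ 1)
        (ψ : SpinChain.State d n) (_ : SpinChain.IsGroundState (SpinChain.hamiltonian h) ψ)
        (α : ℝ) (_ : 0 < α) (_ : α < 1)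
        (R : ℝ) (_ : ∀ k : ℕ, 1 ≤ k → k < n → SpinChain.renyiEntropy α ψ k ≤ R)
        (δ : ℝ) (_ : 0 < δ) (_ : δ ≤ 1),
        ∃ φ : SpinChain.MPS d n,
          ‖φ.state‖ = 1 ∧
          (φ.bondDim : ℝ) ≤ Real.exp R * (C / δ) ^ (2 * α / (1 - α)) ∧
          SpinChain.expectation (SpinChain.hamiltonian h) φ.state
            ≤ SpinChain.groundEnergy (SpinChain.hamiltonian h) + n * δ := by
  open SpinChain in
  -- The energy loss per spin is `32 s`, so `s = δ / 32` and the rank bound contains `1 / s = 32 /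
  -- δ`.
  refine ⟨32, by norm_num, ?_⟩
  intro n hn h hH hh ψ hψ α hα0 hα1 R hR δ hδ0 hδ1
  set s : ℝ := δ / 32 with hs
  have hs0 : 0 < s := by positivity
  have hs1 : s ≤ 1 / 32 := by rw [hs]; linarith
  have hsinv : s⁻¹ = 32 / δ := by rw [hs, inv_div]
  have htr := fun (k : ℕ) (h1 : 1 ≤ k) (h2 : k < n) =>
    exists_truncation ψ hψ.1 k hα0 hα1 (hR k h1 h2) hs0 (by linarith)
  rw [hsinv] at htr
  set x := Real.exp R * (32 / δ) ^ (2 * α / (1 - α)) with hx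
  have hx0 : 0 ≤ x := by positivity
  choose! P Q r hPa hQa hPh hPP hQh hQQ hPQ herr hr1 hrx hrank using htr
  choose G hGa hGE hG2 using fun i => exists_bond_factor (n := n) i (hH i) (hh i)
  -- The ranks vary with the cut; the floor of the real bound is a common integer bound.
  have hrD : ∀ k, 1 ≤ k → k < n → r k ≤ ⌊x⌋₊ := fun k h1 h2 => Nat.le_floor (hrx k h1 h2)
  have hD1 : 1 ≤ ⌊x⌋₊ := (hr1 1 le_rfl (by omega)).trans (hrD 1 le_rfl (by omega))
  have D : TruncData ψ G P Q s ⌊x⌋₊ :=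
    ⟨hψ.1, hs0, by linarith, hGa, hG2, hD1, hPa, hQa, hPh, hPP, hQh, hQQ, hPQ, herr,
      fun k h1 h2 f => (hrank k h1 h2 f).mono (hrD k h1 h2)⟩
  have hL1 : 1 ≤ (⌈s⁻¹⌉₊ : ℝ) * s := by
    have := mul_le_mul_of_nonneg_right (Nat.le_ceil s⁻¹) hs0.le
    rwa [inv_mul_cancel₀ hs0.ne'] at this
  have hL2 : (⌈s⁻¹⌉₊ : ℝ) * s ≤ 2 := by
    have := mul_le_mul_of_nonneg_right (Nat.ceil_lt_add_one (inv_nonneg.2 hs0.le)).le hs0.le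
    rw [add_mul, inv_mul_cancel₀ hs0.ne'] at this
    linarith
  obtain ⟨f, hf0, -, hfR, hfE⟩ := D.exists_prefix hL1 hL2 n le_rfl (by omega)
  rw [bondsIn_univ (by omega)] at hfE
  have hfn : 0 < ‖f‖ := norm_pos_iff.2 hf0
  set c : ℂ := ((‖f‖⁻¹ : ℝ) : ℂ) with hc
  have hcn : ‖c‖ = ‖f‖⁻¹ := by
    rw [hc, Complex.norm_real, norm_inv, norm_norm]
  have hφn : ‖c • f‖ = 1 := by rw [norm_smul, hcn, inv_mul_cancel₀ hfn.ne']
  obtain ⟨M, hM, hMD⟩ := exists_mps (f := c • f) (by omega)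
    (norm_ne_zero_iff.1 (by rw [hφn]; norm_num)) hD1 (fun k => (hfR k).smul c)
  refine ⟨M, by rw [hM, hφn], (Nat.cast_le.2 hMD).trans (Nat.floor_le hx0), ?_⟩
  -- The shift by 1 on each bond is the same for all unit vectors and cancels when two energies are
  -- compared.
  have hE : ∀ g : State d n, ‖g‖ = 1 →
      expectation (hamiltonian h) g = ∑ i, ‖op (G i) g‖ ^ 2 - ∑ _i : Fin (n - 1), (1 : ℝ) := by
    intro g hg
    rw [expectation_hamiltonian, ← Finset.sum_sub_distrib]
    refine Finset.sum_congr rfl fun i _ => ?_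
    rw [hGE, hg]; ring
  have hscale : ∑ i, ‖op (G i) (c • f)‖ ^ 2 ≤ ∑ i, ‖op (G i) ψ‖ ^ 2 + 32 * s * n := by
    have : ∀ i, ‖op (G i) (c • f)‖ ^ 2 = ‖op (G i) f‖ ^ 2 / ‖f‖ ^ 2 := by
      intro i
      rw [map_smul, norm_smul, hcn, mul_pow, inv_pow]
      ring
    simp_rw [this]
    rw [← Finset.sum_div, div_le_iff₀ (by positivity)]
    exact hfE
  rw [hM, hE _ hφn, ← hψ.expectation_eq, hE _ hψ.1]
  have : 32 * s * n = n * δ := by rw [hs]; ring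
  linarith
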